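/- All manifolds are smooth, finite-dimensional, Hausdorff and without boundary. A Poisson–Nijenhuis structure on a manifold $M$ is a pair $(\Pi, N)$ of a smooth bivector field $\Pi$ with $[\Pi,\Pi]=0$ (Schouten bracket) and a smooth $(1,1)$-tensor $N$ with vanishing Nijenhuis torsion $\tau N(X,Y)=[NX,NY]-N[NX,Y]-N[X,NY]+N^2[X,Y]$, such that $N\circ\Pi^\sharp=\Pi^\sharp\circ N^*$ and $C(\Pi,N)(\alpha,\beta)=[\alpha,\beta]_{N\Pi}-\big([N^*\alpha,\beta]_\Pi+[\alpha,N^*\beta]_\Pi-N^*[\alpha,\beta]_\Pi\big)=0$ for all one-forms $\alpha,\beta$, where $\Pi^\sharp\alpha=\Pi(\alpha,\cdot)$ and $[\alpha,\beta]_\Pi=\mathcal L_{\Pi^\sharp\alpha}\beta-\mathcal L_{\Pi^\sharp\beta}\alpha-d(\Pi(\alpha,\beta))$. A Lie group $G$ with Lie algebra $\mathfrak g=T_1G$ and a Poisson–Nijenhuis structure $(\Pi_G,N_G)$ is right-invariant if there are $\Lambda_G\in\wedge^2\mathfrak g$ and a linear map $n_G:\mathfrak g\to\mathfrak g$ with $\Pi_G=\overrightarrow{\Lambda_G}$,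 $N_G=\overrightarrow{n_G}$, where $\overrightarrow{\Lambda_G}(a)=\wedge^2dR_a(\Lambda_G)$ and $\overrightarrow{n_G}(a)=dR_a\circ n_G\circ dR_{a^{-1}}$. Let $\Gamma\rightrightarrows B$ be a Lie groupoid with source $\alpha$ and target $\beta$, where $gh$ is defined when $\alpha(g)=\beta(h)$. Its Lie algebroid $A\Gamma$ has fibre $\ker(d\alpha)$ at the unit $1_x$, and $R_g:\alpha^{-1}(\beta(g))\to\alpha^{-1}(\alpha(g))$, $h\mapsto hg$. For $\Lambda\in\Gamma(\wedge^2A\Gamma)$ put $\overrightarrow{\Lambda}(g)=\wedge^2dR_g(\Lambda(\beta(g)))$; for a smooth bundle endomorphism $n$ of $A\Gamma$ put $\overrightarrow{n}(v)=dR_g\big(n(dR_{g^{-1}}v)\big)$ for $v\in\ker(d\alpha)_g$. A Poisson–Nijenhuis structure $(\Pi,N)$ on the manifold $\Gamma$, together with a Nijenhuis tensor $N_B$ on $B$ satisfying $d\beta\circ N=N_B\circ d\beta$, is right-invariant if $\Pi=\overrightarrow{\Lambda}$ for some smooth section $\Lambda$ of $\wedge^2A\Gamma$ and $N=\overrightarrow{n}$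 on $\ker(d\alpha)$ for some smooth bundle endomorphism $n$ of $A\Gamma$. **Proposition.** Let $(M,\Pi_M,N_M)$ be a Poisson–Nijenhuis manifold and $(G,\Pi_G,N_G)$ a right-invariant Poisson–Nijenhuis Lie group. Let $\Upsilon=M\times G\times M\rightrightarrows M$ be the trivial Lie groupoid, with target $(x,a,y)\mapsto x$, source $(x,a,y)\mapsto y$, product $(x,a,y)(y,b,z)=(x,ab,z)$, units $(x,1,x)$ and inverses $(x,a,y)^{-1}=(y,a^{-1},x)$; its Lie algebroid is identified with $TM\oplus(M\times\mathfrak g)$ through $(X,V)\mapsto(X,V,0)$. Then $$\Pi_\Upsilon=\Pi_M\oplus\Pi_G\oplus0,\qquad N_\Upsilon=N_M\oplus N_G\oplus0$$ is a right-invariant Poisson–Nijenhuis structure on $\Upsilon$, with base tensor $N_M$. Concretely, whenever $\Pi_G=\overrightarrow{\Lambda_G}$, the section $\Lambda_M\oplus\Lambda_G$ of $\wedge^2(TM\oplus(M\times\mathfrak g))$, with $\Lambda_M=\Pi_M$, is smooth and $\Pi_\Upsilon=\overrightarrow{\Lambda_M\oplus\Lambda_G}$; and whenever $N_G=\overrightarrow{n_G}$,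 the bundle endomorphism $n_M\oplus n_G$, with $n_M=N_M$, is smooth and $N_\Upsilon=\overrightarrow{n_M\oplus n_G}$ on $\ker(d\alpha)$. -/

import Mathlib

open scoped Manifold ContDiff

noncomputable section

/-! ### Bivectors on a vector space -/

/-- A bivector on a finite-dimensional real vector space `V`, i.e. an element of `∧² V`, given by
its (skew-symmetric) sharp map `P♯ : V* → V`, `P♯ α = P(α, ·)`. -/
structure Bivector (V : Type*) [AddCommGroup V] [Module ℝ V] [TopologicalSpace V] where
  sharp : (V →L[ℝ] ℝ) →ₗ[ℝ] V
  alt : ∀ α : V →L[ℝ] ℝ, α (sharp α) = 0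

namespace Bivector

variable {V W : Type*} [AddCommGroup V] [Module ℝ V] [TopologicalSpace V]
  [AddCommGroup W] [Module ℝ W] [TopologicalSpace W]

/-- The value `P(α, β)` of a bivector on two covectors. -/
def eval (P : Bivector V) (α β : V →L[ℝ] ℝ) : ℝ := β (P.sharp α)

/-- The zero bivector. -/
def zero : Bivector V where
  sharp := 0
  alt α := by simp

/-- The push-forward `∧² f : ∧² V → ∧² W` along a linear map `f`. -/
def map (f : V →L[ℝ] W) (P : Bivector V) : Bivector W where
  sharp :=
    { toFun := fun α => f (P.sharp (α.comp f))
      map_add' := fun α β => by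
        rw [ContinuousLinearMap.add_comp, map_add, map_add]
      map_smul' := fun c α => by
        rw [ContinuousLinearMap.smul_comp, map_smul, map_smul, RingHom.id_apply] }
  alt α := P.alt (α.comp f)

/-- The direct sum `P ⊕ Q ∈ ∧² V ⊕ ∧² W ⊆ ∧² (V × W)`. -/
def prod (P : Bivector V) (Q : Bivector W) : Bivector (V × W) where
  sharp :=
    { toFun := fun α =>
        (P.sharp (α.comp (ContinuousLinearMap.inl ℝ V W)),
          Q.sharp (α.comp (ContinuousLinearMap.inr ℝ V W)))
      map_add' := fun α β => by
        simp [ContinuousLinearMap.add_comp]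
      map_smul' := fun c α => by
        simp [ContinuousLinearMap.smul_comp] }
  alt α := by
    have h1 := P.alt (α.comp (ContinuousLinearMap.inl ℝ V W))
    have h2 := Q.alt (α.comp (ContinuousLinearMap.inr ℝ V W))
    simp only [LinearMap.coe_mk, AddHom.coe_mk]
    rw [← Prod.fst_add_snd (P.sharp (α.comp (ContinuousLinearMap.inl ℝ V W)),
      Q.sharp (α.comp (ContinuousLinearMap.inr ℝ V W))), map_add]
    simpa using congrArg₂ (· + ·) h1 h2

end Bivector

/-! ### Tensor fields and Poisson–Nijenhuis structures on a manifold

Manifolds are smooth, finite-dimensional, Hausdorff and without boundary wherever these notions are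
applied, so that a tensor field is determined by, and its smoothness can be tested on, globally
defined smooth functions, vector fields and one-forms. -/

section Manifold

variable {E : Type*} [NormedAddCommGroup E] [NormedSpace ℝ E] {H : Type*} [TopologicalSpace H]
  (I : ModelWithCorners ℝ E H) {M : Type*} [TopologicalSpace M] [ChartedSpace H M]
  [IsManifold I ∞ M]

/-- The differential `df` at `x`, as a covector. -/
def dif (f : M → ℝ) (x : M) : TangentSpace I x →L[ℝ] ℝ := mfderiv I 𝓘(ℝ, ℝ) f x

/-- `f ∈ C^∞(M)`. -/
def SmoothFun (f : M → ℝ) : Prop := ContMDiff I 𝓘(ℝ, ℝ) ∞ f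

/-- `X` is a smooth vector field. -/
def SmoothVF (X : ∀ x : M, TangentSpace I x) : Prop :=
  ContMDiff I I.tangent ∞ (fun x => (⟨x, X x⟩ : TangentBundle I M))

/-- `α` is a smooth one-form: it is smooth as a fibrewise linear function on `TM`. -/
def SmoothForm (α : ∀ x : M, TangentSpace I x →L[ℝ] ℝ) : Prop :=
  ContMDiff I.tangent 𝓘(ℝ, ℝ) ∞ (fun v : TangentBundle I M => α v.1 v.2)

/-- `N` is a smooth `(1,1)`-tensor: it is smooth as a bundle map `TM → TM`. -/
def SmoothEndo (N : ∀ x : M, TangentSpace I x →L[ℝ] TangentSpace I x) : Prop :=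
  ContMDiff I.tangent I.tangent ∞
    (fun v : TangentBundle I M => (⟨v.1, N v.1 v.2⟩ : TangentBundle I M))

/-- The function `{f, h}_P = P(df, dh)`. -/
def bivectorBracket (P : ∀ x : M, Bivector (TangentSpace I x)) (f h : M → ℝ) : M → ℝ :=
  fun x => (P x).eval (dif I f x) (dif I h x)

/-- `P` is a smooth bivector field. -/
def SmoothBivector (P : ∀ x : M, Bivector (TangentSpace I x)) : Prop :=
  ∀ f h : M → ℝ, SmoothFun I f → SmoothFun I h → SmoothFun I (bivectorBracket I P f h)

/-- The Schouten bracket `[P, Q]` of two bivector fields, a trivector field, evaluated on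
`df`, `dg`, `dh`. -/
def schoutenBracket (P Q : ∀ x : M, Bivector (TangentSpace I x)) (f g h : M → ℝ) : M → ℝ :=
  let p := bivectorBracket I P
  let q := bivectorBracket I Q
  fun x =>
    (p (q f g) h x + p (q g h) f x + p (q h f) g x) +
      (q (p f g) h x + q (p g h) f x + q (p h f) g x)

/-- `P` is a Poisson structure: a smooth bivector field with `[P, P] = 0`. -/
def IsPoisson (P : ∀ x : M, Bivector (TangentSpace I x)) : Prop :=
  SmoothBivector I P ∧
    ∀ f g h : M → ℝ, SmoothFun I f → SmoothFun I g → SmoothFun I h →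
      ∀ x, schoutenBracket I P P f g h x = 0

/-- The Nijenhuis torsion
`τN(X, Y) = [NX, NY] - N[NX, Y] - N[X, NY] + N²[X, Y]`. -/
def nijenhuisTorsion (N : ∀ x : M, TangentSpace I x →L[ℝ] TangentSpace I x)
    (X Y : ∀ x : M, TangentSpace I x) (x : M) : TangentSpace I x :=
  VectorField.mlieBracket I (fun y => N y (X y)) (fun y => N y (Y y)) x
    - N x (VectorField.mlieBracket I (fun y => N y (X y)) Y x)
    - N x (VectorField.mlieBracket I X (fun y => N y (Y y)) x)
    + N x (N x (VectorField.mlieBracket I X Y x))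

/-- `N` is a Nijenhuis tensor: a smooth `(1,1)`-tensor with vanishing torsion. -/
def IsNijenhuis (N : ∀ x : M, TangentSpace I x →L[ℝ] TangentSpace I x) : Prop :=
  SmoothEndo I N ∧
    ∀ X Y : (∀ x : M, TangentSpace I x), SmoothVF I X → SmoothVF I Y →
      ∀ x, nijenhuisTorsion I N X Y x = 0

/-- The Lie derivative of a one-form, evaluated on a vector field:
`(L_X β)(Y) = X(β(Y)) - β([X, Y])`. -/
def lieDerivForm (X : ∀ x : M, TangentSpace I x) (β : ∀ x : M, TangentSpace I x →L[ℝ] ℝ)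
    (Y : ∀ x : M, TangentSpace I x) (x : M) : ℝ :=
  dif I (fun y => β y (Y y)) x (X x) - β x (VectorField.mlieBracket I X Y x)

/-- The bracket of one-forms, evaluated on a vector field `Y`:
`[α, β]_P = L_{P♯α} β - L_{P♯β} α - d(P(α, β))`.
It takes the sharp map of `P` as its argument. -/
def formBracket (P : ∀ x : M, (TangentSpace I x →L[ℝ] ℝ) → TangentSpace I x)
    (α β : ∀ x : M, TangentSpace I x →L[ℝ] ℝ) (Y : ∀ x : M, TangentSpace I x) (x : M) : ℝ :=
  lieDerivForm I (fun y => P y (α y)) β Y x - lieDerivForm I (fun y => P y (β y)) α Y x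
    - dif I (fun y => β y (P y (α y))) x (Y x)

/-- The Magri–Morosi concomitant, evaluated on a vector field `Y`:
`C(P, N)(α, β) = [α, β]_{NP} - ([N*α, β]_P + [α, N*β]_P - N*[α, β]_P)`. -/
def concomitant (P : ∀ x : M, Bivector (TangentSpace I x))
    (N : ∀ x : M, TangentSpace I x →L[ℝ] TangentSpace I x)
    (α β : ∀ x : M, TangentSpace I x →L[ℝ] ℝ) (Y : ∀ x : M, TangentSpace I x) (x : M) : ℝ :=
  formBracket I (fun y ξ => N y ((P y).sharp ξ)) α β Y x
    - (formBracket I (fun y => (P y).sharp) (fun y => (α y).comp (N y)) β Y x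
      + formBracket I (fun y => (P y).sharp) α (fun y => (β y).comp (N y)) Y x
      - formBracket I (fun y => (P y).sharp) α β (fun y => N y (Y y)) x)

/-- `(P, N)` is a Poisson–Nijenhuis structure on `M`. -/
structure IsPoissonNijenhuis (P : ∀ x : M, Bivector (TangentSpace I x))
    (N : ∀ x : M, TangentSpace I x →L[ℝ] TangentSpace I x) : Prop where
  poisson : IsPoisson I P
  nijenhuis : IsNijenhuis I N
  /-- `N ∘ P♯ = P♯ ∘ N*` -/
  comm : ∀ (x : M) (ξ : TangentSpace I x →L[ℝ] ℝ),
    N x ((P x).sharp ξ) = (P x).sharp (ξ.comp (N x))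
  concomitant_eq_zero : ∀ α β : (∀ x : M, TangentSpace I x →L[ℝ] ℝ),
    SmoothForm I α → SmoothForm I β → ∀ Y : (∀ x : M, TangentSpace I x), SmoothVF I Y →
      ∀ x, concomitant I P N α β Y x = 0

end Manifold

/-! ### Right-invariant Poisson–Nijenhuis Lie groups -/

section LieGrp

variable {F : Type*} [NormedAddCommGroup F] [NormedSpace ℝ F] {K : Type*} [TopologicalSpace K]
  (J : ModelWithCorners ℝ F K) {G : Type*} [TopologicalSpace G] [ChartedSpace K G] [Group G]
  [LieGroup J ∞ G]

/-- `dR_a : 𝔤 = T_1 G → T_a G`. -/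
def groupRight (a : G) : GroupLieAlgebra J G →L[ℝ] TangentSpace J a :=
  mfderiv J J (fun b : G => b * a) 1

/-- `dR_{a⁻¹} : T_a G → T_1 G = 𝔤`. -/
def groupRightInv (a : G) : TangentSpace J a →L[ℝ] GroupLieAlgebra J G :=
  mfderiv J J (fun b : G => b * a⁻¹) a

/-- The right-invariant bivector field on `G` with value `Λ` at the identity. -/
def groupBivector (Λ : Bivector (GroupLieAlgebra J G)) (a : G) : Bivector (TangentSpace J a) :=
  Λ.map (groupRight J a)

/-- The right-invariant `(1,1)`-tensor on `G` with value `n` at the identity. -/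
def groupEndo (n : GroupLieAlgebra J G →L[ℝ] GroupLieAlgebra J G) (a : G) :
    TangentSpace J a →L[ℝ] TangentSpace J a :=
  (groupRight J a).comp (n.comp (groupRightInv J a))

/-- `(G, P, N)` is a right-invariant Poisson–Nijenhuis Lie group. -/
structure IsRightInvariantPNGroup (P : ∀ a : G, Bivector (TangentSpace J a))
    (N : ∀ a : G, TangentSpace J a →L[ℝ] TangentSpace J a) : Prop where
  pn : IsPoissonNijenhuis J P N
  bivector : ∃ Λ : Bivector (GroupLieAlgebra J G), P = groupBivector J Λ
  endo : ∃ n : GroupLieAlgebra J G →L[ℝ] GroupLieAlgebra J G, N = groupEndo J n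

end LieGrp

/-! ### Lie groupoids and right-invariant Poisson–Nijenhuis structures on them -/

section Groupoid

variable {E : Type*} [NormedAddCommGroup E] [NormedSpace ℝ E] {H : Type*} [TopologicalSpace H]
  {F : Type*} [NormedAddCommGroup F] [NormedSpace ℝ F] {K : Type*} [TopologicalSpace K]

/-- A Lie groupoid `Γ ⇉ B`, with source `src`, target `tgt`, units and inverses. The product
`mul g h` is meaningful when `src g = tgt h`; its other values are irrelevant. As the set of
composable pairs is an embedded submanifold of `Γ × Γ`, smoothness of the product on this
submanifold is `ContMDiffOn`. -/
structure LieGroupoid (I : ModelWithCorners ℝ E H) (Γ : Type*) [TopologicalSpace Γ]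
    [ChartedSpace H Γ] [IsManifold I ∞ Γ] (J : ModelWithCorners ℝ F K) (B : Type*) [TopologicalSpace B]
    [ChartedSpace K B] [IsManifold J ∞ B] where
  src : Γ → B
  tgt : Γ → B
  unit : B → Γ
  inv : Γ → Γ
  mul : Γ → Γ → Γ
  src_mul : ∀ g h, src g = tgt h → src (mul g h) = src h
  tgt_mul : ∀ g h, src g = tgt h → tgt (mul g h) = tgt g
  mul_assoc : ∀ g h k, src g = tgt h → src h = tgt k → mul (mul g h) k = mul g (mul h k)
  src_unit : ∀ x, src (unit x) = x
  tgt_unit : ∀ x, tgt (unit x) = x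
  mul_unit : ∀ g, mul g (unit (src g)) = g
  unit_mul : ∀ g, mul (unit (tgt g)) g = g
  src_inv : ∀ g, src (inv g) = tgt g
  tgt_inv : ∀ g, tgt (inv g) = src g
  mul_inv : ∀ g, mul g (inv g) = unit (tgt g)
  inv_mul : ∀ g, mul (inv g) g = unit (src g)
  smooth_src : ContMDiff I J ∞ src
  smooth_tgt : ContMDiff I J ∞ tgt
  smooth_unit : ContMDiff J I ∞ unit
  smooth_inv : ContMDiff I I ∞ inv
  smooth_mul : ContMDiffOn (I.prod I) I ∞ (fun p : Γ × Γ => mul p.1 p.2)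
    {p | src p.1 = tgt p.2}
  submersion_src : ∀ g, Function.Surjective (mfderiv I J src g)
  submersion_tgt : ∀ g, Function.Surjective (mfderiv I J tgt g)

namespace LieGroupoid

variable {I : ModelWithCorners ℝ E H} {Γ : Type*} [TopologicalSpace Γ]
  [ChartedSpace H Γ] [IsManifold I ∞ Γ] {J : ModelWithCorners ℝ F K} {B : Type*} [TopologicalSpace B]
  [ChartedSpace K B] [IsManifold J ∞ B] (S : LieGroupoid I Γ J B)

/-- The space `ker (d src)_g` of vectors at `g` tangent to the source fibre. -/
def vertical (g : Γ) : Submodule ℝ (TangentSpace I g) :=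
  LinearMap.ker (mfderiv I J S.src g).toLinearMap

/-- The fibre at `x` of the Lie algebroid: the vertical space at the unit of `x`. -/
abbrev algebroid (x : B) : Submodule ℝ (TangentSpace I (S.unit x)) := S.vertical (S.unit x)

/-- The right translation `R_g : h ↦ h g`, defined on the source fibre over `tgt g`. -/
def rightTrans (g : Γ) : Γ → Γ := fun h => S.mul h g

/-- The source fibre on which `R_g` is defined. -/
def rightDomain (g : Γ) : Set Γ := {h | S.src h = S.tgt g}

/-- The derivative of `R_g : src⁻¹(tgt g) → Γ` at the unit over `tgt g`. Only its values on
vertical vectors matter; there, the derivative within the source fibre is unambiguous. -/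
def dRight (g : Γ) : TangentSpace I (S.unit (S.tgt g)) →L[ℝ] TangentSpace I g :=
  mfderivWithin I I (S.rightTrans g) (S.rightDomain g) (S.unit (S.tgt g))

/-- The derivative of `R_{g⁻¹} : src⁻¹(src g) → Γ` at `g`; it takes values at
`g g⁻¹ = unit (tgt g)`. Again only its values on vertical vectors matter. -/
def dRightInv (g : Γ) : TangentSpace I g →L[ℝ] TangentSpace I (S.unit (S.tgt g)) :=
  mfderivWithin I I (S.rightTrans (S.inv g)) (S.rightDomain (S.inv g)) g

/-- The bivector field `Λ→(g) = ∧² dR_g (Λ(tgt g))` on `Γ`. -/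
def rightBivector (Λ : ∀ x, Bivector (S.algebroid x)) (g : Γ) : Bivector (TangentSpace I g) :=
  (Λ (S.tgt g)).map ((S.dRight g).comp (S.algebroid (S.tgt g)).subtypeL)

/-- `a` is a smooth section of the Lie algebroid. -/
def SmoothSection (a : ∀ x, S.algebroid x) : Prop :=
  ContMDiff J I.tangent ∞ (fun x => (⟨S.unit x, (a x : TangentSpace I (S.unit x))⟩ :
    TangentBundle I Γ))

/-- `Λ` is a smooth section of the second exterior power of the Lie algebroid. -/
def SmoothBivectorSection (Λ : ∀ x, Bivector (S.algebroid x)) : Prop :=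
  ∀ f h : Γ → ℝ, SmoothFun I f → SmoothFun I h →
    SmoothFun J (fun x => (Λ x).eval
      ((dif I f (S.unit x)).comp (S.algebroid x).subtypeL)
      ((dif I h (S.unit x)).comp (S.algebroid x).subtypeL))

/-- `n` is a smooth bundle endomorphism of the Lie algebroid, i.e. it acts on smooth sections. -/
def SmoothEndoSection (n : ∀ x, S.algebroid x →L[ℝ] S.algebroid x) : Prop :=
  ∀ a : (∀ x, S.algebroid x), S.SmoothSection a → S.SmoothSection (fun x => n x (a x))

/-- `N = n→`, that is, for all `g` and all vertical `v` at `g`, the vector `dR_{g⁻¹} v` lies in the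
Lie algebroid and `N v = dR_g (n (dR_{g⁻¹} v))`. -/
def IsRightEndo (n : ∀ x, S.algebroid x →L[ℝ] S.algebroid x)
    (N : ∀ g : Γ, TangentSpace I g →L[ℝ] TangentSpace I g) : Prop :=
  ∀ g : Γ, ∀ v ∈ S.vertical g, ∃ a : S.algebroid (S.tgt g),
    (a : TangentSpace I (S.unit (S.tgt g))) = S.dRightInv g v ∧
      N g v = S.dRight g (n (S.tgt g) a)

/-- `(P, (N, NB))` is a right-invariant Poisson–Nijenhuis structure on the Lie groupoid, where
`NB` is the Nijenhuis tensor induced by `N` on the base (along the target map). -/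
structure IsRightInvariantPN (P : ∀ g : Γ, Bivector (TangentSpace I g))
    (N : ∀ g : Γ, TangentSpace I g →L[ℝ] TangentSpace I g)
    (NB : ∀ x : B, TangentSpace J x →L[ℝ] TangentSpace J x) : Prop where
  pn : IsPoissonNijenhuis I P N
  bivector : ∃ Λ : (∀ x, Bivector (S.algebroid x)),
    S.SmoothBivectorSection Λ ∧ P = S.rightBivector Λ
  endo : ∃ n : (∀ x, S.algebroid x →L[ℝ] S.algebroid x),
    S.SmoothEndoSection n ∧ S.IsRightEndo n N
  base_nijenhuis : IsNijenhuis J NB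
  base_related : ∀ (g : Γ) (v : TangentSpace I g),
    mfderiv I J S.tgt g (N g v) = NB (S.tgt g) (mfderiv I J S.tgt g v)

end LieGroupoid

end Groupoid

/-! ### The trivial Lie groupoid `M × G × M ⇉ M` -/

section Trivial

variable {E : Type*} [NormedAddCommGroup E] [NormedSpace ℝ E] {H : Type*} [TopologicalSpace H]
  (I : ModelWithCorners ℝ E H) {M : Type*} [TopologicalSpace M] [ChartedSpace H M]
  {F : Type*} [NormedAddCommGroup F] [NormedSpace ℝ F] {K : Type*} [TopologicalSpace K]
  (J : ModelWithCorners ℝ F K) {G : Type*} [TopologicalSpace G] [ChartedSpace K G]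

/-- The canonical identification `T_x M × T_a G × T_y M = T_{(x, a, y)} (M × G × M)`. -/
def tangentTriple (p : M × G × M) :
    (TangentSpace I p.1 × TangentSpace J p.2.1 × TangentSpace I p.2.2) ≃L[ℝ]
      TangentSpace (I.prod (J.prod I)) p :=
  ContinuousLinearEquiv.refl ℝ (E × F × E)

/-- The bivector field `P_M ⊕ P_G ⊕ 0` on `M × G × M`. -/
def tripleBivector (PM : ∀ x : M, Bivector (TangentSpace I x))
    (PG : ∀ a : G, Bivector (TangentSpace J a)) (p : M × G × M) :
    Bivector (TangentSpace (I.prod (J.prod I)) p) :=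
  ((PM p.1).prod ((PG p.2.1).prod Bivector.zero)).map (tangentTriple I J p).toContinuousLinearMap

/-- The `(1,1)`-tensor `N_M ⊕ N_G ⊕ 0` on `M × G × M`. -/
def tripleEndo (NM : ∀ x : M, TangentSpace I x →L[ℝ] TangentSpace I x)
    (NG : ∀ a : G, TangentSpace J a →L[ℝ] TangentSpace J a) (p : M × G × M) :
    TangentSpace (I.prod (J.prod I)) p →L[ℝ] TangentSpace (I.prod (J.prod I)) p :=
  (tangentTriple I J p).toContinuousLinearMap.comp
    (((NM p.1).prodMap ((NG p.2.1).prodMap 0)).comp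
      (tangentTriple I J p).symm.toContinuousLinearMap)

variable (M G) [IsManifold I ∞ M] [Group G] [LieGroup J ∞ G]

/-- The trivial Lie groupoid `M × G × M ⇉ M`: the arrow `(x, a, y)` has target `x` and source `y`,
and `(x, a, y) (y, b, z) = (x, a b, z)`. -/
def trivialGroupoid : LieGroupoid (I.prod (J.prod I)) (M × G × M) I M where
  src p := p.2.2
  tgt p := p.1
  unit x := (x, 1, x)
  inv p := (p.2.2, p.2.1⁻¹, p.1)
  mul p q := (p.1, p.2.1 * q.2.1, q.2.2)
  src_mul _ _ _ := rfl
  tgt_mul _ _ _ := rfl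
  mul_assoc _ _ _ _ _ := by simp [mul_assoc]
  src_unit _ := rfl
  tgt_unit _ := rfl
  mul_unit _ := by simp
  unit_mul _ := by simp
  src_inv _ := rfl
  tgt_inv _ := rfl
  mul_inv _ := by simp
  inv_mul _ := by simp
  smooth_src := contMDiff_snd.comp contMDiff_snd
  smooth_tgt := contMDiff_fst
  smooth_unit := contMDiff_id.prodMk (contMDiff_const.prodMk contMDiff_id)
  smooth_inv := (contMDiff_snd.comp contMDiff_snd).prodMk
    (((contMDiff_fst.comp contMDiff_snd).inv).prodMk contMDiff_fst)
  smooth_mul := ((contMDiff_fst.comp contMDiff_fst).prodMk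
    (((contMDiff_fst.comp (contMDiff_snd.comp contMDiff_fst)).mul
      (contMDiff_fst.comp (contMDiff_snd.comp contMDiff_snd))).prodMk
      (contMDiff_snd.comp (contMDiff_snd.comp contMDiff_snd)))).contMDiffOn
  submersion_src p v := by
    have h : HasMFDerivAt (I.prod (J.prod I)) I (fun q : M × G × M => q.2.2) p
        ((ContinuousLinearMap.snd ℝ (TangentSpace J p.2.1) (TangentSpace I p.2.2)).comp
          (ContinuousLinearMap.snd ℝ (TangentSpace I p.1) (TangentSpace (J.prod I) p.2))) :=
      (hasMFDerivAt_snd p.2).comp p (hasMFDerivAt_snd p)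
    rw [h.mfderiv]
    exact ⟨tangentTriple I J p (0, 0, v), rfl⟩
  submersion_tgt p v := by
    rw [mfderiv_fst]
    exact ⟨tangentTriple I J p (v, 0, 0), rfl⟩

variable {M G}

/-- The vertical space of the trivial groupoid at `p` consists of the vectors `(X, V, 0)`. -/
theorem mem_vertical_trivialGroupoid (p : M × G × M)
    (w : TangentSpace I p.1 × TangentSpace J p.2.1 × TangentSpace I p.2.2) :
    tangentTriple I J p w ∈ (trivialGroupoid I M J G).vertical p ↔ w.2.2 = 0 := by
  have h : HasMFDerivAt (I.prod (J.prod I)) I (trivialGroupoid I M J G).src p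
      ((ContinuousLinearMap.snd ℝ (TangentSpace J p.2.1) (TangentSpace I p.2.2)).comp
        (ContinuousLinearMap.snd ℝ (TangentSpace I p.1) (TangentSpace (J.prod I) p.2))) :=
    (hasMFDerivAt_snd p.2).comp p (hasMFDerivAt_snd p)
  rw [LieGroupoid.vertical, h.mfderiv]
  rfl

/-- The canonical identification of the Lie algebroid of the trivial groupoid with
`TM ⊕ (M × 𝔤)`; on fibres, `(X, V) ↦ (X, V, 0)`. -/
def trivialAlgebroid (x : M) :
    (TangentSpace I x × GroupLieAlgebra J G) ≃L[ℝ] (trivialGroupoid I M J G).algebroid x where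
  toFun w := ⟨tangentTriple I J (x, 1, x) (w.1, w.2, 0),
    (mem_vertical_trivialGroupoid I J (x, 1, x) (w.1, w.2, 0)).2 rfl⟩
  invFun a := (((tangentTriple I J (x, 1, x)).symm a.1).1,
    ((tangentTriple I J (x, 1, x)).symm a.1).2.1)
  left_inv w := rfl
  right_inv a := by
    have h := (mem_vertical_trivialGroupoid I J (x, 1, x)
      ((tangentTriple I J (x, 1, x)).symm a.1)).1 a.2
    apply Subtype.ext
    apply (tangentTriple I J (x, 1, x)).symm.injective
    exact Prod.ext rfl (Prod.ext rfl h.symm)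
  map_add' v w := by
    apply Subtype.ext
    apply (tangentTriple I J (x, 1, x)).symm.injective
    exact Prod.ext rfl (Prod.ext rfl (add_zero (0 : TangentSpace I x)).symm)
  map_smul' c w := by
    apply Subtype.ext
    apply (tangentTriple I J (x, 1, x)).symm.injective
    exact Prod.ext rfl (Prod.ext rfl (smul_zero c : c • (0 : TangentSpace I x) = 0).symm)
  continuous_toFun := ((tangentTriple I J (x, (1 : G), x)).continuous.comp
    (continuous_fst.prodMk (continuous_snd.prodMk continuous_const))).subtype_mk _
  continuous_invFun := by
    have h := (tangentTriple I J (x, (1 : G), x)).symm.continuous.comp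
      (continuous_subtype_val (p := (· ∈ (trivialGroupoid I M J G).algebroid x)))
    exact (continuous_fst.comp h).prodMk (continuous_fst.comp (continuous_snd.comp h))

/-- The section `Λ_M ⊕ Λ_G` of the second exterior power of `TM ⊕ (M × 𝔤)`. -/
def trivialBivector (ΛM : ∀ x : M, Bivector (TangentSpace I x))
    (ΛG : Bivector (GroupLieAlgebra J G)) (x : M) :
    Bivector ((trivialGroupoid I M J G).algebroid x) :=
  ((ΛM x).prod ΛG).map (trivialAlgebroid I J x).toContinuousLinearMap

/-- The bundle endomorphism `n_M ⊕ n_G` of `TM ⊕ (M × 𝔤)`. -/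
def trivialEndo (nM : ∀ x : M, TangentSpace I x →L[ℝ] TangentSpace I x)
    (nG : GroupLieAlgebra J G →L[ℝ] GroupLieAlgebra J G) (x : M) :
    (trivialGroupoid I M J G).algebroid x →L[ℝ] (trivialGroupoid I M J G).algebroid x :=
  (trivialAlgebroid I J x).toContinuousLinearMap.comp
    (((nM x).prodMap nG).comp (trivialAlgebroid I J x).symm.toContinuousLinearMap)

end Trivial

end

noncomputable section

set_option linter.unusedSectionVars false

section Chart
open Set Filter Topology

variable {E : Type*} [NormedAddCommGroup E] [NormedSpace ℝ E] {H : Type*} [TopologicalSpace H]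
  (I : ModelWithCorners ℝ E H) {M : Type*} [TopologicalSpace M] [ChartedSpace H M]
  {V W : Type*} [NormedAddCommGroup V] [NormedSpace ℝ V] [NormedAddCommGroup W] [NormedSpace ℝ W]

/-- The derivative at `x` of a map to a normed space, read in the preferred chart at `x`. -/
def chartDeriv (f : M → V) (x : M) : E →L[ℝ] V :=
  fderiv ℝ (f ∘ (extChartAt I x).symm) (extChartAt I x x)

variable {I} [I.Boundaryless]

theorem MDifferentiableAt.differentiableAt_chart {f : M → V} {x : M}
    (hf : MDifferentiableAt I 𝓘(ℝ, V) f x) :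
    DifferentiableAt ℝ (f ∘ (extChartAt I x).symm) (extChartAt I x x) := by
  have h := hf.differentiableWithinAt_writtenInExtChartAt
  rw [I.range_eq_univ, differentiableWithinAt_univ] at h
  exact h

theorem mfderiv_eq_chartDeriv {f : M → V} {x : M} (hf : MDifferentiableAt I 𝓘(ℝ, V) f x) :
    mfderiv I 𝓘(ℝ, V) f x = chartDeriv I f x := by
  rw [hf.mfderiv, I.range_eq_univ, fderivWithin_univ]
  rfl

theorem dif_eq_chartDeriv {f : M → ℝ} {x : M} (hf : MDifferentiableAt I 𝓘(ℝ, ℝ) f x) :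
    dif I f x = chartDeriv I f x :=
  mfderiv_eq_chartDeriv hf

theorem chartDeriv_clm_apply {f : M → V →L[ℝ] W} {g : M → V} {x : M}
    (hf : MDifferentiableAt I 𝓘(ℝ, V →L[ℝ] W) f x) (hg : MDifferentiableAt I 𝓘(ℝ, V) g x)
    (v : E) :
    chartDeriv I (fun y => f y (g y)) x v =
      chartDeriv I f x v (g x) + f x (chartDeriv I g x v) := by
  have h := (hf.differentiableAt_chart.hasFDerivAt.clm_apply
    hg.differentiableAt_chart.hasFDerivAt).fderiv
  have := congrArg (fun L => L v) h
  simp only [Function.comp_apply, extChartAt_to_inv] at this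
  rw [add_comm]
  exact this

theorem chartDeriv_clm_comp (L : V →L[ℝ] W) {g : M → V} {x : M}
    (hg : MDifferentiableAt I 𝓘(ℝ, V) g x) (v : E) :
    chartDeriv I (fun y => L (g y)) x v = L (chartDeriv I g x v) :=
  congrArg (fun L => L v) (L.hasFDerivAt.comp _ hg.differentiableAt_chart.hasFDerivAt).fderiv

theorem chartDeriv_add {f g : M → V} {x : M} (hf : MDifferentiableAt I 𝓘(ℝ, V) f x)
    (hg : MDifferentiableAt I 𝓘(ℝ, V) g x) (v : E) :
    chartDeriv I (fun y => f y + g y) x v = chartDeriv I f x v + chartDeriv I g x v :=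
  congrArg (fun L => L v)
    (hf.differentiableAt_chart.hasFDerivAt.add hg.differentiableAt_chart.hasFDerivAt).fderiv

theorem ContMDiffAt.contDiffAt_chart {n : WithTop ℕ∞} {f : M → V} {x : M}
    (hf : ContMDiffAt I 𝓘(ℝ, V) n f x) :
    ContDiffAt ℝ n (f ∘ (extChartAt I x).symm) (extChartAt I x x) := by
  have := (contMDiffAt_iff.1 hf).2
  rw [I.range_eq_univ, contDiffWithinAt_univ] at this
  exact this

variable (I) in
/-- A vector field read in the preferred chart at `x`. -/
def chartField (x : M) (Z : ∀ x : M, TangentSpace I x) (z : E) : E :=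
  VectorField.mpullbackWithin 𝓘(ℝ, E) I (extChartAt I x).symm Z (range I) z

section
variable [IsManifold I ∞ M]


theorem chartField_self (x : M) (Z : ∀ x : M, TangentSpace I x) :
    chartField I x Z (extChartAt I x x) = Z x := by
  have h := mfderivWithin_extChartAt_symm_inverse_apply (I := I) (x := x)
    (Z ((extChartAt I x).symm (extChartAt I x x)))
  refine Eq.trans h ?_
  have : ∀ y, y = x → (Z y : E) = Z x := by rintro y rfl; rfl
  exact this _ (extChartAt_to_inv x)

theorem differentiableAt_chartField [CompleteSpace E] {x : M} {Z : ∀ x : M, TangentSpace I x}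
    (hZ : MDifferentiableAt I I.tangent (fun y => (⟨y, Z y⟩ : TangentBundle I M)) x) :
    DifferentiableAt ℝ (chartField I x Z) (extChartAt I x x) := by
  have h : DifferentiableWithinAt ℝ (chartField I x Z)
      ((extChartAt I x).symm ⁻¹' univ ∩ range I) (extChartAt I x x) :=
    MDifferentiableWithinAt.differentiableWithinAt_mpullbackWithin_vectorField
      (mdifferentiableWithinAt_univ.2 hZ)
  rwa [preimage_univ, univ_inter, I.range_eq_univ, differentiableWithinAt_univ] at h

theorem mlieBracket_eq_chartField (x : M) (X Y : ∀ x : M, TangentSpace I x) :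
    VectorField.mlieBracket I X Y x =
      fderiv ℝ (chartField I x Y) (extChartAt I x x) (X x) -
        fderiv ℝ (chartField I x X) (extChartAt I x x) (Y x) := by
  have h : VectorField.mlieBracket I X Y x = (mfderiv I 𝓘(ℝ, E) (extChartAt I x) x).inverse
      (show E from VectorField.lieBracketWithin ℝ (chartField I x X) (chartField I x Y)
        ((extChartAt I x).symm ⁻¹' univ ∩ range I) (extChartAt I x x)) := rfl
  have hinv : ∀ v : E, (mfderiv I 𝓘(ℝ, E) (extChartAt I x) x).inverse v = v := by
    intro v
    rw [mfderiv_extChartAt_self]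
    exact congrArg (fun L : E →L[ℝ] E => L v) ContinuousLinearMap.inverse_id
  rw [h, preimage_univ, univ_inter, I.range_eq_univ, VectorField.lieBracketWithin_univ]
  refine (hinv _).trans ?_
  rw [← chartField_self x X, ← chartField_self x Y]
  rfl

theorem dif_eq_fderiv_chartField {f : M → ℝ} {x : M} (hf : ContMDiffAt I 𝓘(ℝ, ℝ) ∞ f x)
    (Z : ∀ x : M, TangentSpace I x) :
    (fun y => dif I f y (Z y)) ∘ (extChartAt I x).symm =ᶠ[𝓝 (extChartAt I x x)]
      fun z => fderiv ℝ (f ∘ (extChartAt I x).symm) z (chartField I x Z z) := by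
  have hfm : ∀ᶠ z in 𝓝 (extChartAt I x x),
      MDifferentiableAt I 𝓘(ℝ, ℝ) f ((extChartAt I x).symm z) := by
    have h1 : ∀ᶠ y in 𝓝 x, MDifferentiableAt I 𝓘(ℝ, ℝ) f y := by
      have h2 : ContMDiffAt I 𝓘(ℝ, ℝ) 1 f x := hf.of_le ENat.LEInfty.out
      filter_upwards [(contMDiffAt_iff_contMDiffAt_nhds (by simp)).1 h2] with y hy
      exact hy.mdifferentiableAt one_ne_zero
    have h3 := continuousAt_extChartAt_symm (I := I) x
    rw [ContinuousAt, extChartAt_to_inv] at h3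
    exact h3.eventually h1
  filter_upwards [hfm, extChartAt_target_mem_nhds (I := I) x] with z hz hzt
  have hs : MDifferentiableAt 𝓘(ℝ, E) I (extChartAt I x).symm z := by
    have := mdifferentiableWithinAt_extChartAt_symm (I := I) hzt
    rwa [I.range_eq_univ, mdifferentiableWithinAt_univ] at this
  have hinv := isInvertible_mfderivWithin_extChartAt_symm (I := I) hzt
  have hc := mfderiv_comp z hz hs
  rw [chartField, VectorField.mpullbackWithin_apply]
  rw [I.range_eq_univ, mfderivWithin_univ] at hinv ⊢
  rw [mfderiv_eq_fderiv] at hc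
  rw [hc]
  obtain ⟨e, he⟩ := hinv
  rw [← he]
  change _ = ((mfderiv I 𝓘(ℝ, ℝ) f ((extChartAt I x).symm z)).comp e.toContinuousLinearMap) _
  rw [ContinuousLinearMap.inverse_equiv]
  exact congrArg (mfderiv I 𝓘(ℝ, ℝ) f ((extChartAt I x).symm z)) (e.apply_symm_apply _).symm

/-- A smooth function acts on the Lie bracket of two vector fields by the commutator of the
two directional derivatives. -/
theorem dif_mlieBracket [CompleteSpace E] {f : M → ℝ} {x : M}
    {X Y : ∀ x : M, TangentSpace I x} (hf : ContMDiffAt I 𝓘(ℝ, ℝ) ∞ f x)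
    (hX : MDifferentiableAt I I.tangent (fun y => (⟨y, X y⟩ : TangentBundle I M)) x)
    (hY : MDifferentiableAt I I.tangent (fun y => (⟨y, Y y⟩ : TangentBundle I M)) x) :
    dif I f x (VectorField.mlieBracket I X Y x) =
      chartDeriv I (fun y => dif I f y (Y y)) x (X x) -
        chartDeriv I (fun y => dif I f y (X y)) x (Y x) := by
  have hfn := hf.contDiffAt_chart
  have hcd : ∀ Z Z' : (∀ x : M, TangentSpace I x),
      MDifferentiableAt I I.tangent (fun y => (⟨y, Z y⟩ : TangentBundle I M)) x →
      chartDeriv I (fun y => dif I f y (Z y)) x (Z' x) =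
        fderiv ℝ (fderiv ℝ (f ∘ (extChartAt I x).symm)) (extChartAt I x x) (Z' x) (Z x) +
          fderiv ℝ (f ∘ (extChartAt I x).symm) (extChartAt I x x)
            (fderiv ℝ (chartField I x Z) (extChartAt I x x) (Z' x)) := by
    intro Z Z' hZ
    have h2 : DifferentiableAt ℝ (fderiv ℝ (f ∘ (extChartAt I x).symm)) (extChartAt I x x) :=
      ((hfn.fderiv_right (m := 1) (by norm_num; exact ENat.LEInfty.out)).differentiableAt
        one_ne_zero)
    have h := (h2.hasFDerivAt.clm_apply (differentiableAt_chartField hZ).hasFDerivAt).fderiv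
    have h' := (Filter.EventuallyEq.fderiv_eq (dif_eq_fderiv_chartField hf Z)).trans h
    have := congrArg (fun L => L (Z' x)) h'
    rw [chartField_self] at this
    rw [add_comm]
    exact this
  have hsymm : IsSymmSndFDerivAt ℝ (f ∘ (extChartAt I x).symm) (extChartAt I x x) :=
    hfn.isSymmSndFDerivAt (by simp; exact ENat.LEInfty.out)
  rw [hcd Y X hY, hcd X Y hX, mlieBracket_eq_chartField,
    dif_eq_chartDeriv (hf.mdifferentiableAt (by simp))]
  have h := hsymm.eq (X x) (Y x)
  refine (map_sub (fderiv ℝ (f ∘ (extChartAt I x).symm) (extChartAt I x x)) _ _).trans ?_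
  linear_combination -h

end
end Chart

section Smooth
open Set Filter Topology

variable {E : Type*} [NormedAddCommGroup E] [NormedSpace ℝ E] {H : Type*} [TopologicalSpace H]
  {I : ModelWithCorners ℝ E H} {M : Type*} [TopologicalSpace M] [ChartedSpace H M]
  [IsManifold I ∞ M]
  {F : Type*} [NormedAddCommGroup F] [NormedSpace ℝ F] {K : Type*} [TopologicalSpace K]
  {J : ModelWithCorners ℝ F K} {Q : Type*} [TopologicalSpace Q] [ChartedSpace K Q]
  [IsManifold J ∞ Q]
  {D : Type*} [NormedAddCommGroup D] [NormedSpace ℝ D] {L : Type*} [TopologicalSpace L]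
  {R : ModelWithCorners ℝ D L} {Z : Type*} [TopologicalSpace Z] [ChartedSpace L Z]
  {V : Type*} [NormedAddCommGroup V] [NormedSpace ℝ V]

theorem trivializationAt_self_apply (c : M) (v : TangentSpace I c) :
    (trivializationAt E (TangentSpace I) c (⟨c, v⟩ : TangentBundle I M)).2 = v := by
  have h1 := TangentBundle.continuousLinearMapAt_trivializationAt (I := I) (mem_chart_source H c)
  rw [mfderiv_extChartAt_self] at h1
  have h2 := congrArg (fun T : TangentSpace I c →L[ℝ] E => T v) h1
  rw [Bundle.Trivialization.continuousLinearMapAt_apply,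
    Bundle.Trivialization.coe_linearMapAt_of_mem] at h2
  · exact h2
  · exact FiberBundle.mem_baseSet_trivializationAt' c

/-- Smoothness of a map into a single tangent space. -/
theorem contMDiffAt_mk_const_iff {n : WithTop ℕ∞} (c : M) (v : Z → E) (z : Z) :
    ContMDiffAt R I.tangent n (fun z => (⟨c, v z⟩ : TangentBundle I M)) z ↔
      ContMDiffAt R 𝓘(ℝ, E) n v z := by
  rw [Bundle.contMDiffAt_totalSpace]
  have : (fun z => (trivializationAt E (TangentSpace I) c (⟨c, v z⟩ : TangentBundle I M)).2) =
      v := by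
    funext z; exact trivializationAt_self_apply c (v z)
  simp only [this]
  exact ⟨fun h => h.2, fun h => ⟨contMDiffAt_const, h⟩⟩

theorem contMDiff_mk_const_iff {n : WithTop ℕ∞} (c : M) (v : Z → E) :
    ContMDiff R I.tangent n (fun z => (⟨c, v z⟩ : TangentBundle I M)) ↔
      ContMDiff R 𝓘(ℝ, E) n v :=
  forall_congr' fun z => contMDiffAt_mk_const_iff c v z

/-- A map into the tangent bundle of a product is smooth if both components are. -/
theorem ContMDiffAt.tangentProdMk {n : WithTop ℕ∞} {a : Z → M} {b : Z → Q}
    {u : ∀ z, TangentSpace I (a z)} {w : ∀ z, TangentSpace J (b z)} {z : Z}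
    (ha : ContMDiffAt R I.tangent n (fun z => (⟨a z, u z⟩ : TangentBundle I M)) z)
    (hb : ContMDiffAt R J.tangent n (fun z => (⟨b z, w z⟩ : TangentBundle J Q)) z) :
    ContMDiffAt R (I.prod J).tangent n
      (fun z => (⟨(a z, b z), (u z, w z)⟩ : TangentBundle (I.prod J) (M × Q))) z :=
  (contMDiff_equivTangentBundleProd_symm (I := I) (I' := J) (M := M) (M' := Q)).contMDiffAt.comp z
    (ha.prodMk hb)

theorem ContMDiff.tangentProdMk {n : WithTop ℕ∞} {a : Z → M} {b : Z → Q}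
    {u : ∀ z, TangentSpace I (a z)} {w : ∀ z, TangentSpace J (b z)}
    (ha : ContMDiff R I.tangent n (fun z => (⟨a z, u z⟩ : TangentBundle I M)))
    (hb : ContMDiff R J.tangent n (fun z => (⟨b z, w z⟩ : TangentBundle J Q))) :
    ContMDiff R (I.prod J).tangent n
      (fun z => (⟨(a z, b z), (u z, w z)⟩ : TangentBundle (I.prod J) (M × Q))) :=
  fun z => (ha z).tangentProdMk (hb z)

theorem contMDiff_tangent_fst {n : WithTop ℕ∞} : ContMDiff (I.prod J).tangent I.tangent n
    (fun v : TangentBundle (I.prod J) (M × Q) => (⟨v.1.1, v.2.1⟩ : TangentBundle I M)) :=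
  contMDiff_fst.comp (contMDiff_equivTangentBundleProd (I := I) (I' := J) (M := M) (M' := Q))

theorem contMDiff_tangent_snd {n : WithTop ℕ∞} : ContMDiff (I.prod J).tangent J.tangent n
    (fun v : TangentBundle (I.prod J) (M × Q) => (⟨v.1.2, v.2.2⟩ : TangentBundle J Q)) :=
  contMDiff_snd.comp (contMDiff_equivTangentBundleProd (I := I) (I' := J) (M := M) (M' := Q))

theorem contMDiff_of_clm_apply [FiniteDimensional ℝ E] {n : WithTop ℕ∞} {f : Z → E →L[ℝ] V}
    (h : ∀ e, ContMDiff R 𝓘(ℝ, V) n (fun z => f z e)) : ContMDiff R 𝓘(ℝ, E →L[ℝ] V) n f := by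
  let b := Module.finBasis ℝ E
  have hf : f = fun z => ∑ i, ContinuousLinearMap.smulRightL ℝ E V
      (b.coord i).toContinuousLinearMap (f z (b i)) := by
    funext z
    ext e
    conv_lhs => rw [← b.sum_repr e, map_sum]
    simp
  rw [hf]
  refine contMDiff_finsetSum fun i _ => ?_
  exact (ContinuousLinearMap.contMDiff _).comp (h (b i))

/-! ### Tensor fields -/

theorem SmoothFun.smoothForm_dif {f : M → ℝ} (hf : SmoothFun I f) : SmoothForm I (dif I f) :=
  (contMDiff_snd_tangentBundle_modelSpace ℝ 𝓘(ℝ, ℝ)).comp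
    (ContMDiff.contMDiff_tangentMap hf (m := ∞) (by simp))

theorem SmoothForm.apply {α : ∀ x : M, TangentSpace I x →L[ℝ] ℝ} (hα : SmoothForm I α)
    {X : ∀ x : M, TangentSpace I x} (hX : SmoothVF I X) : SmoothFun I (fun x => α x (X x)) :=
  ContMDiff.comp (g := fun v : TangentBundle I M => α v.1 v.2) hα hX

theorem SmoothEndo.apply {N : ∀ x : M, TangentSpace I x →L[ℝ] TangentSpace I x}
    (hN : SmoothEndo I N) {X : ∀ x : M, TangentSpace I x} (hX : SmoothVF I X) :
    SmoothVF I (fun x => N x (X x)) :=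
  ContMDiff.comp (g := fun v : TangentBundle I M => (⟨v.1, N v.1 v.2⟩ : TangentBundle I M)) hN hX

theorem SmoothForm.comp {α : ∀ x : M, TangentSpace I x →L[ℝ] ℝ} (hα : SmoothForm I α)
    {N : ∀ x : M, TangentSpace I x →L[ℝ] TangentSpace I x} (hN : SmoothEndo I N) :
    SmoothForm I (fun x => (α x).comp (N x)) :=
  ContMDiff.comp (g := fun v : TangentBundle I M => α v.1 v.2) hα hN

theorem SmoothVF.mdifferentiableAt {X : ∀ x : M, TangentSpace I x} (hX : SmoothVF I X) (x : M) :
    MDifferentiableAt I I.tangent (fun y => (⟨y, X y⟩ : TangentBundle I M)) x :=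
  ContMDiff.mdifferentiableAt hX (by simp)

theorem SmoothFun.mdifferentiableAt {f : M → ℝ} (hf : SmoothFun I f) (x : M) :
    MDifferentiableAt I 𝓘(ℝ, ℝ) f x :=
  ContMDiff.mdifferentiableAt hf (by simp)

/-! ### Slices of tensor fields on a product -/

section Slices

theorem SmoothFun.slice_fst {f : M × Q → ℝ} (hf : SmoothFun (I.prod J) f) (q : Q) :
    SmoothFun I (fun x => f (x, q)) :=
  ContMDiff.comp (g := f) hf (contMDiff_id.prodMk contMDiff_const)

theorem SmoothFun.slice_snd {f : M × Q → ℝ} (hf : SmoothFun (I.prod J) f) (x : M) :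
    SmoothFun J (fun q => f (x, q)) :=
  ContMDiff.comp (g := f) hf (contMDiff_const.prodMk contMDiff_id)

theorem dif_prod_apply {f : M × Q → ℝ} {p : M × Q}
    (hf : MDifferentiableAt (I.prod J) 𝓘(ℝ, ℝ) f p) (v : TangentSpace (I.prod J) p) :
    dif (I.prod J) f p v =
      dif I (fun x => f (x, p.2)) p.1 v.1 + dif J (fun q => f (p.1, q)) p.2 v.2 :=
  mfderiv_prod_eq_add_apply hf

/-- The component along the first factor of a covector on a product. -/
def coFst {p : M × Q} (ξ : TangentSpace (I.prod J) p →L[ℝ] ℝ) : TangentSpace I p.1 →L[ℝ] ℝ :=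
  ξ.comp (ContinuousLinearMap.inl ℝ (TangentSpace I p.1) (TangentSpace J p.2))

/-- The component along the second factor of a covector on a product. -/
def coSnd {p : M × Q} (ξ : TangentSpace (I.prod J) p →L[ℝ] ℝ) : TangentSpace J p.2 →L[ℝ] ℝ :=
  ξ.comp (ContinuousLinearMap.inr ℝ (TangentSpace I p.1) (TangentSpace J p.2))

theorem apply_eq_coFst_add_coSnd {p : M × Q} (ξ : TangentSpace (I.prod J) p →L[ℝ] ℝ)
    (v : TangentSpace (I.prod J) p) : ξ v = coFst ξ v.1 + coSnd ξ v.2 := by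
  have h : v = ((v.1, 0) : E × F) + ((0, v.2) : E × F) := by
    refine Prod.ext ?_ ?_
    · exact (add_zero (v.1 : E)).symm
    · exact (zero_add (v.2 : F)).symm
  exact (congrArg ξ h).trans (map_add ξ _ _)

theorem coFst_dif {f : M × Q → ℝ} {p : M × Q}
    (hf : MDifferentiableAt (I.prod J) 𝓘(ℝ, ℝ) f p) :
    coFst (dif (I.prod J) f p) = dif I (fun x => f (x, p.2)) p.1 := by
  ext v
  refine (dif_prod_apply hf (v, 0)).trans ?_
  exact (congrArg _ (map_zero (dif J (fun q => f (p.1, q)) p.2))).trans (add_zero _)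

theorem coSnd_dif {f : M × Q → ℝ} {p : M × Q}
    (hf : MDifferentiableAt (I.prod J) 𝓘(ℝ, ℝ) f p) :
    coSnd (dif (I.prod J) f p) = dif J (fun q => f (p.1, q)) p.2 := by
  ext v
  refine (dif_prod_apply hf (0, v)).trans ?_
  exact (congrArg (· + _) (map_zero (dif I (fun x => f (x, p.2)) p.1))).trans (zero_add _)

variable {X : ∀ p : M × Q, TangentSpace (I.prod J) p} 
  {α : ∀ p : M × Q, TangentSpace (I.prod J) p →L[ℝ] ℝ}

theorem SmoothVF.slice_fst (hX : SmoothVF (I.prod J) X) (q : Q) :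
    SmoothVF I (fun x => (X (x, q)).1) :=
  contMDiff_tangent_fst.comp (ContMDiff.comp hX (contMDiff_id.prodMk contMDiff_const))

theorem SmoothVF.slice_snd (hX : SmoothVF (I.prod J) X) (x : M) :
    SmoothVF J (fun q => (X (x, q)).2) :=
  contMDiff_tangent_snd.comp (ContMDiff.comp hX (contMDiff_const.prodMk contMDiff_id))

/-- The first component of a vector field on `M × Q` along `{x} × Q`. -/
def fstAlong (X : ∀ p : M × Q, TangentSpace (I.prod J) p) (x : M) (q : Q) : E := (X (x, q)).1

/-- The second component of a vector field on `M × Q` along `M × {q}`. -/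
def sndAlong (X : ∀ p : M × Q, TangentSpace (I.prod J) p) (q : Q) (x : M) : F := (X (x, q)).2

/-- The first component of a one-form on `M × Q` along `{x} × Q`. -/
def coFstAlong (α : ∀ p : M × Q, TangentSpace (I.prod J) p →L[ℝ] ℝ) (x : M) (q : Q) :
    E →L[ℝ] ℝ := coFst (α (x, q))

/-- The second component of a one-form on `M × Q` along `M × {q}`. -/
def coSndAlong (α : ∀ p : M × Q, TangentSpace (I.prod J) p →L[ℝ] ℝ) (q : Q) (x : M) :
    F →L[ℝ] ℝ := coSnd (α (x, q))

theorem SmoothVF.contMDiff_fstAlong (hX : SmoothVF (I.prod J) X) (x : M) :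
    ContMDiff J 𝓘(ℝ, E) ∞ (fstAlong X x) :=
  (contMDiff_mk_const_iff x (fstAlong X x)).1
    (contMDiff_tangent_fst.comp (ContMDiff.comp hX (contMDiff_const.prodMk contMDiff_id)))

theorem SmoothVF.contMDiff_sndAlong (hX : SmoothVF (I.prod J) X) (q : Q) :
    ContMDiff I 𝓘(ℝ, F) ∞ (sndAlong X q) :=
  (contMDiff_mk_const_iff q (sndAlong X q)).1
    (contMDiff_tangent_snd.comp (ContMDiff.comp hX (contMDiff_id.prodMk contMDiff_const)))

theorem contMDiff_tangent_zero {a : Z → M} (ha : ContMDiff R I ∞ a) :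
    ContMDiff R I.tangent ∞ (fun z => (⟨a z, 0⟩ : TangentBundle I M)) :=
  (Bundle.contMDiff_zeroSection ℝ (TangentSpace I : M → Type _)).comp ha

theorem SmoothForm.slice_fst (hα : SmoothForm (I.prod J) α) (q : Q) :
    SmoothForm I (fun x => coFst (α (x, q))) :=
  ContMDiff.comp (g := fun v : TangentBundle (I.prod J) (M × Q) => α v.1 v.2) hα
    (ContMDiff.tangentProdMk contMDiff_id (contMDiff_tangent_zero contMDiff_const))

theorem SmoothForm.slice_snd (hα : SmoothForm (I.prod J) α) (x : M) :
    SmoothForm J (fun q => coSnd (α (x, q))) :=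
  ContMDiff.comp (g := fun v : TangentBundle (I.prod J) (M × Q) => α v.1 v.2) hα
    (ContMDiff.tangentProdMk (contMDiff_tangent_zero contMDiff_const) contMDiff_id)

theorem SmoothForm.contMDiff_coFstAlong [FiniteDimensional ℝ E] (hα : SmoothForm (I.prod J) α) (x : M) :
    ContMDiff J 𝓘(ℝ, E →L[ℝ] ℝ) ∞ (coFstAlong α x) :=
  contMDiff_of_clm_apply fun e =>
    ContMDiff.comp (g := fun v : TangentBundle (I.prod J) (M × Q) => α v.1 v.2) hα
      (ContMDiff.tangentProdMk (u := fun _ => (e : TangentSpace I x))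
        contMDiff_const (contMDiff_tangent_zero contMDiff_id))

theorem SmoothForm.contMDiff_coSndAlong [FiniteDimensional ℝ F] (hα : SmoothForm (I.prod J) α) (q : Q) :
    ContMDiff I 𝓘(ℝ, F →L[ℝ] ℝ) ∞ (coSndAlong α q) :=
  contMDiff_of_clm_apply fun e =>
    ContMDiff.comp (g := fun v : TangentBundle (I.prod J) (M × Q) => α v.1 v.2) hα
      (ContMDiff.tangentProdMk (w := fun _ => (e : TangentSpace J q))
        (contMDiff_tangent_zero contMDiff_id) contMDiff_const)

end Slices
end Smooth

section Frame
open Set Filter Topology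

variable {E : Type*} [NormedAddCommGroup E] [NormedSpace ℝ E] [FiniteDimensional ℝ E]
  {H : Type*} [TopologicalSpace H]
  {I : ModelWithCorners ℝ E H} {M : Type*} [TopologicalSpace M] [ChartedSpace H M]
  [IsManifold I ∞ M] [T2Space M]

variable (I) in
/-- Linear coordinates at a point extend, locally around it, to globally smooth functions. -/
theorem exists_smoothFun_eventuallyEq (x : M) (l : E →L[ℝ] ℝ) :
    ∃ φ : M → ℝ, SmoothFun I φ ∧ φ =ᶠ[𝓝 x] fun y => l (extChartAt I x y) := by
  let χ : SmoothBumpFunction I x := Classical.arbitrary _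
  refine ⟨fun y => χ y • l (extChartAt I x y), χ.contMDiff_smul ?_, ?_⟩
  · exact l.contMDiff.comp_contMDiffOn (contMDiffOn_extChartAt (I := I) (n := ∞) (x := x))
  · filter_upwards [χ.eventuallyEq_one] with y hy
    simp [hy]

variable (I) in
/-- Around every point there are globally smooth functions `φ i` and a smooth local frame `e i`
dual to the differentials of the `φ i`. -/
theorem exists_dual_frame (x₀ : M) :
    ∃ (φ : Fin (Module.finrank ℝ E) → M → ℝ)
      (e : Fin (Module.finrank ℝ E) → ∀ x : M, TangentSpace I x),
      (∀ i, SmoothFun I (φ i)) ∧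
      (∀ i, ContMDiffAt I I.tangent ∞ (fun x => (⟨x, e i x⟩ : TangentBundle I M)) x₀) ∧
      ∀ᶠ x in 𝓝 x₀, ∀ v : TangentSpace I x, v = ∑ i, dif I (φ i) x v • e i x := by
  let b := Module.finBasis ℝ E
  choose φ hφ hφe using fun i : Fin (Module.finrank ℝ E) =>
    exists_smoothFun_eventuallyEq I x₀ (b.coord i).toContinuousLinearMap
  let T := trivializationAt E (TangentSpace I) x₀
  have hx₀ : x₀ ∈ T.baseSet := FiberBundle.mem_baseSet_trivializationAt' x₀
  refine ⟨φ, T.localFrame b, hφ, fun i => contMDiffAt_localFrame_of_mem ∞ T b i hx₀, ?_⟩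
  have h1 : ∀ᶠ x in 𝓝 x₀, ∀ i, φ i =ᶠ[𝓝 x] fun y => b.coord i (extChartAt I x₀ y) :=
    eventually_all.2 fun i => (hφe i).eventuallyEq_nhds
  filter_upwards [h1, T.open_baseSet.mem_nhds hx₀, (chartAt H x₀).open_source.mem_nhds
    (mem_chart_source H x₀)] with x hx hxT hxs v
  have hd : ∀ i, dif I (φ i) x v = (T.basisAt b hxT).repr v i := by
    intro i
    have h2 : MDifferentiableAt I 𝓘(ℝ, E) (extChartAt I x₀) x := mdifferentiableAt_extChartAt hxs
    have h3 := mfderiv_comp (I' := 𝓘(ℝ, E)) x (g := (b.coord i).toContinuousLinearMap)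
      (LinearMap.toContinuousLinearMap (b.coord i)).mdifferentiableAt h2
    rw [ContinuousLinearMap.mfderiv_eq] at h3
    have h4 : dif I (φ i) x v = b.coord i (mfderiv I 𝓘(ℝ, E) (extChartAt I x₀) x v) := by
      rw [dif, (hx i).mfderiv_eq]
      exact congrArg (fun L : TangentSpace I x →L[ℝ] ℝ => L v) h3
    rw [h4, ← TangentBundle.continuousLinearMapAt_trivializationAt hxs]
    simp only [Bundle.Trivialization.basisAt, Module.Basis.map_repr, LinearEquiv.trans_apply,
      LinearEquiv.symm_symm]
    have h5 : T.continuousLinearMapAt ℝ x v = T.linearEquivAt ℝ x hxT v := by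
      rw [Bundle.Trivialization.continuousLinearMapAt_apply,
        Bundle.Trivialization.coe_linearMapAt_of_mem _ hxT]
      rfl
    exact congrArg (b.coord i) h5
  conv_lhs => rw [← (T.basisAt b hxT).sum_repr v]
  exact Finset.sum_congr rfl fun i _ => by
    rw [hd, Bundle.Trivialization.localFrame_apply_of_mem_baseSet]

/-- A tangent vector is determined by its action on smooth functions. -/
theorem eq_of_forall_smoothFun_dif_eq {x : M} {v w : TangentSpace I x}
    (h : ∀ f : M → ℝ, SmoothFun I f → dif I f x v = dif I f x w) : v = w := by
  obtain ⟨φ, e, hφ, -, he⟩ := exists_dual_frame I x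
  rw [he.self_of_nhds v, he.self_of_nhds w]
  exact Finset.sum_congr rfl fun i _ => by rw [h _ (hφ i)]

theorem covector_eq_sum {x : M} {ι : Type*} [Fintype ι]
    {θ : ι → TangentSpace I x →L[ℝ] ℝ} {e : ι → TangentSpace I x}
    (h : ∀ v, v = ∑ i, θ i v • e i) (ξ : TangentSpace I x →L[ℝ] ℝ) : ξ = ∑ i, ξ (e i) • θ i := by
  ext v
  conv_lhs => rw [h v]
  simp [mul_comm]

theorem Bivector.eval_eq_sum_left {x : M} (P : Bivector (TangentSpace I x)) {ι : Type*} [Fintype ι]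
    {θ : ι → TangentSpace I x →L[ℝ] ℝ} {e : ι → TangentSpace I x}
    (h : ∀ v, v = ∑ i, θ i v • e i) (ξ η : TangentSpace I x →L[ℝ] ℝ) :
    P.eval ξ η = ∑ i, ξ (e i) * P.eval (θ i) η := by
  unfold Bivector.eval
  conv_lhs => rw [covector_eq_sum h ξ]
  simp only [map_sum, map_smul, smul_eq_mul]

theorem Bivector.eval_eq_sum {x : M} (P : Bivector (TangentSpace I x)) {ι : Type*} [Fintype ι]
    {θ : ι → TangentSpace I x →L[ℝ] ℝ} {e : ι → TangentSpace I x}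
    (h : ∀ v, v = ∑ i, θ i v • e i) (ξ η : TangentSpace I x →L[ℝ] ℝ) :
    P.eval ξ η = ∑ i, ∑ j, ξ (e i) * (η (e j) * P.eval (θ i) (θ j)) := by
  rw [P.eval_eq_sum_left h]
  refine Finset.sum_congr rfl fun i _ => ?_
  rw [← Finset.mul_sum]
  congr 1
  unfold Bivector.eval
  conv_lhs => rw [covector_eq_sum h η]
  simp

/-- The sharp map of a smooth bivector field takes smooth one-forms to smooth vector fields. -/
theorem SmoothBivector.smoothVF_sharp {P : ∀ x : M, Bivector (TangentSpace I x)}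
    (hP : SmoothBivector I P) {α : ∀ x : M, TangentSpace I x →L[ℝ] ℝ} (hα : SmoothForm I α) :
    SmoothVF I (fun x => (P x).sharp (α x)) := by
  intro x₀
  obtain ⟨φ, e, hφ, hes, he⟩ := exists_dual_frame I x₀
  have hc : ∀ i, ContMDiffAt I 𝓘(ℝ, ℝ) ∞ (fun x => α x (e i x)) x₀ := fun i =>
    ContMDiffAt.comp (g := fun v : TangentBundle I M => α v.1 v.2) x₀ hα.contMDiffAt (hes i)
  have hs : ContMDiffAt I I.tangent ∞ (fun x => (⟨x, ∑ j, (∑ i, α x (e i x) *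
      bivectorBracket I P (φ i) (φ j) x) • e j x⟩ : TangentBundle I M)) x₀ := by
    refine ContMDiffAt.sum_section fun j _ => ContMDiffAt.smul_section ?_ (hes j)
    exact contMDiffAt_finsetSum fun i _ => (hc i).mul (hP _ _ (hφ i) (hφ j)).contMDiffAt
  refine hs.congr_of_eventuallyEq ?_
  filter_upwards [he] with x hx
  congr 1
  rw [hx ((P x).sharp (α x))]
  refine Finset.sum_congr rfl fun j _ => ?_
  congr 1
  exact (P x).eval_eq_sum_left hx (α x) (dif I (φ j) x)

end Frame

section Product
open Set Filter Topology

variable {E : Type*} [NormedAddCommGroup E] [NormedSpace ℝ E] [FiniteDimensional ℝ E]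
  {H : Type*} [TopologicalSpace H]
  {I : ModelWithCorners ℝ E H} [I.Boundaryless] {M : Type*} [TopologicalSpace M] [ChartedSpace H M]
  [IsManifold I ∞ M] [T2Space M]
  {F : Type*} [NormedAddCommGroup F] [NormedSpace ℝ F] [FiniteDimensional ℝ F]
  {K : Type*} [TopologicalSpace K]
  {J : ModelWithCorners ℝ F K} [J.Boundaryless] {Q : Type*} [TopologicalSpace Q] [ChartedSpace K Q]
  [IsManifold J ∞ Q] [T2Space Q]
  {V : Type*} [NormedAddCommGroup V] [NormedSpace ℝ V]

theorem chartDeriv_prod_apply {f : M × Q → V} {p : M × Q}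
    (hf : MDifferentiableAt (I.prod J) 𝓘(ℝ, V) f p) (v : E × F) :
    chartDeriv (I.prod J) f p v =
      chartDeriv I (fun x => f (x, p.2)) p.1 v.1 + chartDeriv J (fun q => f (p.1, q)) p.2 v.2 := by
  have h1 : MDifferentiableAt I 𝓘(ℝ, V) (fun x => f (x, p.2)) p.1 :=
    hf.comp p.1 (mdifferentiableAt_id.prodMk mdifferentiableAt_const)
  have h2 : MDifferentiableAt J 𝓘(ℝ, V) (fun q => f (p.1, q)) p.2 :=
    hf.comp p.2 (mdifferentiableAt_const.prodMk mdifferentiableAt_id)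
  rw [← mfderiv_eq_chartDeriv hf, ← mfderiv_eq_chartDeriv h1, ← mfderiv_eq_chartDeriv h2]
  exact mfderiv_prod_eq_add_apply hf

theorem SmoothForm.mdifferentiableAt_coFstAlong
    {α : ∀ p : M × Q, TangentSpace (I.prod J) p →L[ℝ] ℝ}
    (hα : SmoothForm (I.prod J) α) (x : M) (q : Q) :
    MDifferentiableAt J 𝓘(ℝ, E →L[ℝ] ℝ) (coFstAlong α x) q :=
  (hα.contMDiff_coFstAlong x).mdifferentiableAt (by simp)

theorem SmoothForm.mdifferentiableAt_coSndAlong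
    {α : ∀ p : M × Q, TangentSpace (I.prod J) p →L[ℝ] ℝ}
    (hα : SmoothForm (I.prod J) α) (q : Q) (x : M) :
    MDifferentiableAt I 𝓘(ℝ, F →L[ℝ] ℝ) (coSndAlong α q) x :=
  (hα.contMDiff_coSndAlong q).mdifferentiableAt (by simp)

theorem SmoothVF.mdifferentiableAt_fstAlong {X : ∀ p : M × Q, TangentSpace (I.prod J) p}
    (hX : SmoothVF (I.prod J) X) (x : M) (q : Q) :
    MDifferentiableAt J 𝓘(ℝ, E) (fstAlong X x) q :=
  (hX.contMDiff_fstAlong x).mdifferentiableAt (by simp)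

theorem SmoothVF.mdifferentiableAt_sndAlong {X : ∀ p : M × Q, TangentSpace (I.prod J) p}
    (hX : SmoothVF (I.prod J) X) (q : Q) (x : M) :
    MDifferentiableAt I 𝓘(ℝ, F) (sndAlong X q) x :=
  (hX.contMDiff_sndAlong q).mdifferentiableAt (by simp)

/-- The directional derivative of `β(X)` on a product, split along the two factors. -/
theorem dif_apply_prod {β : ∀ p : M × Q, TangentSpace (I.prod J) p →L[ℝ] ℝ}
    (hβ : SmoothForm (I.prod J) β) {X : ∀ p : M × Q, TangentSpace (I.prod J) p}
    (hX : SmoothVF (I.prod J) X) (p : M × Q) (v : TangentSpace (I.prod J) p) :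
    dif (I.prod J) (fun y => β y (X y)) p v =
      (dif I (fun x => coFst (β (x, p.2)) (X (x, p.2)).1) p.1 v.1
        + (chartDeriv I (coSndAlong β p.2) p.1 v.1 (X p).2
        + coSndAlong β p.2 p.1 (chartDeriv I (sndAlong X p.2) p.1 v.1)))
      + (dif J (fun q => coSnd (β (p.1, q)) (X (p.1, q)).2) p.2 v.2
        + (chartDeriv J (coFstAlong β p.1) p.2 v.2 (X p).1
        + coFstAlong β p.1 p.2 (chartDeriv J (fstAlong X p.1) p.2 v.2))) := by
  have hf := hβ.apply hX
  rw [dif_prod_apply (hf.mdifferentiableAt p)]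
  congr 1
  · rw [dif_eq_chartDeriv ((hf.slice_fst p.2).mdifferentiableAt p.1),
      dif_eq_chartDeriv (((hβ.slice_fst p.2).apply (hX.slice_fst p.2)).mdifferentiableAt p.1)]
    have e : (fun x => β (x, p.2) (X (x, p.2))) = fun x =>
        coFst (β (x, p.2)) (X (x, p.2)).1 + coSndAlong β p.2 x (sndAlong X p.2 x) := by
      funext x; exact apply_eq_coFst_add_coSnd _ _
    rw [e]
    refine (chartDeriv_add
      (((hβ.slice_fst p.2).apply (hX.slice_fst p.2)).mdifferentiableAt p.1)
      ((hβ.mdifferentiableAt_coSndAlong p.2 p.1).clm_apply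
        (hX.mdifferentiableAt_sndAlong p.2 p.1)) _).trans ?_
    congr 1
    exact chartDeriv_clm_apply (hβ.mdifferentiableAt_coSndAlong p.2 p.1)
        (hX.mdifferentiableAt_sndAlong p.2 p.1) _
  · rw [dif_eq_chartDeriv ((hf.slice_snd p.1).mdifferentiableAt p.2),
      dif_eq_chartDeriv (((hβ.slice_snd p.1).apply (hX.slice_snd p.1)).mdifferentiableAt p.2)]
    have e : (fun q => β (p.1, q) (X (p.1, q))) = fun q =>
        coSnd (β (p.1, q)) (X (p.1, q)).2 + coFstAlong β p.1 q (fstAlong X p.1 q) := by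
      funext x; exact (apply_eq_coFst_add_coSnd _ _).trans (add_comm _ _)
    rw [e]
    refine (chartDeriv_add
      (((hβ.slice_snd p.1).apply (hX.slice_snd p.1)).mdifferentiableAt p.2)
      ((hβ.mdifferentiableAt_coFstAlong p.1 p.2).clm_apply
        (hX.mdifferentiableAt_fstAlong p.1 p.2)) _).trans ?_
    congr 1
    exact chartDeriv_clm_apply (hβ.mdifferentiableAt_coFstAlong p.1 p.2)
        (hX.mdifferentiableAt_fstAlong p.1 p.2) _

/-- The derivative of the first component of a vector field on `M × Q` along the second factor. -/
def derivFst (X : ∀ p : M × Q, TangentSpace (I.prod J) p) (p : M × Q) (w : TangentSpace J p.2) :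
    TangentSpace I p.1 :=
  chartDeriv J (fstAlong X p.1) p.2 w

/-- The derivative of the second component of a vector field on `M × Q` along the first factor. -/
def derivSnd (X : ∀ p : M × Q, TangentSpace (I.prod J) p) (p : M × Q) (v : TangentSpace I p.1) :
    TangentSpace J p.2 :=
  chartDeriv I (sndAlong X p.2) p.1 v

theorem mlieBracket_prod_fst {X Y : ∀ p : M × Q, TangentSpace (I.prod J) p}
    (hX : SmoothVF (I.prod J) X) (hY : SmoothVF (I.prod J) Y) (p : M × Q) :
    (VectorField.mlieBracket (I.prod J) X Y p).1 =
      VectorField.mlieBracket I (fun x => (X (x, p.2)).1) (fun x => (Y (x, p.2)).1) p.1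
        + (derivFst Y p (X p).2 - derivFst X p (Y p).2) := by
  refine eq_of_forall_smoothFun_dif_eq fun f hf => ?_
  have hf' : SmoothFun (I.prod J) (fun y : M × Q => f y.1) := hf.comp contMDiff_fst
  have hd : ∀ (y : M × Q) (v : TangentSpace (I.prod J) y),
      dif (I.prod J) (fun y : M × Q => f y.1) y v = dif I f y.1 v.1 := by
    intro y v
    rw [dif_prod_apply (hf'.mdifferentiableAt y)]
    simp only [dif, mfderiv_const]
    exact add_zero _
  have h := dif_mlieBracket hf'.contMDiffAt (hX.mdifferentiableAt p) (hY.mdifferentiableAt p)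
  simp only [hd] at h
  have hs : ∀ {Z : ∀ p : M × Q, TangentSpace (I.prod J) p}, SmoothVF (I.prod J) Z →
      ∀ v : TangentSpace (I.prod J) p,
      chartDeriv (I.prod J) (fun y => dif I f y.1 (Z y).1) p v =
        chartDeriv I (fun x => dif I f x (Z (x, p.2)).1) p.1 v.1 +
          dif I f p.1 (chartDeriv J (fstAlong Z p.1) p.2 v.2) := by
    intro Z hZ v
    have hm : ContMDiff (I.prod J) 𝓘(ℝ, ℝ) ∞ (fun y => dif I f y.1 (Z y).1) :=
      ContMDiff.comp (g := fun v : TangentBundle I M => dif I f v.1 v.2) hf.smoothForm_dif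
        (contMDiff_tangent_fst.comp hZ)
    refine (chartDeriv_prod_apply (hm.mdifferentiable (by simp) p) v).trans ?_
    congr 1
    exact chartDeriv_clm_comp (V := E) (show E →L[ℝ] ℝ from dif I f p.1) (hZ.mdifferentiableAt_fstAlong p.1 p.2) _
  rw [hs hX, hs hY] at h
  rw [h]
  have h2 := dif_mlieBracket (x := p.1) hf.contMDiffAt ((hX.slice_fst p.2).mdifferentiableAt p.1)
    ((hY.slice_fst p.2).mdifferentiableAt p.1)
  rw [map_add, h2]
  have h3 := map_sub (dif I f p.1) (derivFst Y p (X p).2) (derivFst X p (Y p).2)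
  unfold derivFst at *
  linear_combination -h3

theorem mlieBracket_prod_snd {X Y : ∀ p : M × Q, TangentSpace (I.prod J) p}
    (hX : SmoothVF (I.prod J) X) (hY : SmoothVF (I.prod J) Y) (p : M × Q) :
    (VectorField.mlieBracket (I.prod J) X Y p).2 =
      VectorField.mlieBracket J (fun q => (X (p.1, q)).2) (fun q => (Y (p.1, q)).2) p.2
        + (derivSnd Y p (X p).1 - derivSnd X p (Y p).1) := by
  refine eq_of_forall_smoothFun_dif_eq fun f hf => ?_
  have hf' : SmoothFun (I.prod J) (fun y : M × Q => f y.2) := hf.comp contMDiff_snd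
  have hd : ∀ (y : M × Q) (v : TangentSpace (I.prod J) y),
      dif (I.prod J) (fun y : M × Q => f y.2) y v = dif J f y.2 v.2 := by
    intro y v
    rw [dif_prod_apply (hf'.mdifferentiableAt y)]
    simp only [dif, mfderiv_const]
    exact zero_add _
  have h := dif_mlieBracket hf'.contMDiffAt (hX.mdifferentiableAt p) (hY.mdifferentiableAt p)
  simp only [hd] at h
  have hs : ∀ {Z : ∀ p : M × Q, TangentSpace (I.prod J) p}, SmoothVF (I.prod J) Z →
      ∀ v : TangentSpace (I.prod J) p,
      chartDeriv (I.prod J) (fun y => dif J f y.2 (Z y).2) p v =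
        dif J f p.2 (chartDeriv I (sndAlong Z p.2) p.1 v.1) +
          chartDeriv J (fun q => dif J f q (Z (p.1, q)).2) p.2 v.2 := by
    intro Z hZ v
    have hm : ContMDiff (I.prod J) 𝓘(ℝ, ℝ) ∞ (fun y => dif J f y.2 (Z y).2) :=
      ContMDiff.comp (g := fun v : TangentBundle J Q => dif J f v.1 v.2) hf.smoothForm_dif
        (contMDiff_tangent_snd.comp hZ)
    refine (chartDeriv_prod_apply (hm.mdifferentiable (by simp) p) v).trans ?_
    congr 1
    exact chartDeriv_clm_comp (V := F) (show F →L[ℝ] ℝ from dif J f p.2)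
      (hZ.mdifferentiableAt_sndAlong p.2 p.1) _
  rw [hs hX, hs hY] at h
  rw [h]
  have h2 := dif_mlieBracket (x := p.2) hf.contMDiffAt ((hX.slice_snd p.1).mdifferentiableAt p.2)
    ((hY.slice_snd p.1).mdifferentiableAt p.2)
  rw [map_add, h2]
  have h3 := map_sub (dif J f p.2) (derivSnd Y p (X p).1) (derivSnd X p (Y p).1)
  unfold derivSnd at *
  linear_combination -h3

/-- The Lie derivative of a one-form on a product, split along the two factors. -/
theorem lieDerivForm_prod {β : ∀ p : M × Q, TangentSpace (I.prod J) p →L[ℝ] ℝ}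
    (hβ : SmoothForm (I.prod J) β) {X Y : ∀ p : M × Q, TangentSpace (I.prod J) p}
    (hX : SmoothVF (I.prod J) X) (hY : SmoothVF (I.prod J) Y) (p : M × Q) :
    lieDerivForm (I.prod J) X β Y p =
      (lieDerivForm I (fun x => (X (x, p.2)).1) (fun x => coFst (β (x, p.2)))
          (fun x => (Y (x, p.2)).1) p.1
        + (chartDeriv J (coFstAlong β p.1) p.2 (X p).2 (Y p).1
        + coFstAlong β p.1 p.2 (chartDeriv J (fstAlong X p.1) p.2 (Y p).2)))
      + (lieDerivForm J (fun q => (X (p.1, q)).2) (fun q => coSnd (β (p.1, q)))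
          (fun q => (Y (p.1, q)).2) p.2
        + (chartDeriv I (coSndAlong β p.2) p.1 (X p).1 (Y p).2
        + coSndAlong β p.2 p.1 (chartDeriv I (sndAlong X p.2) p.1 (Y p).1))) := by
  simp only [lieDerivForm]
  rw [dif_apply_prod hβ hY, apply_eq_coFst_add_coSnd (β p), mlieBracket_prod_fst hX hY,
    mlieBracket_prod_snd hX hY, map_add, map_add]
  have h1 := map_sub (coFst (β p)) (derivFst Y p (X p).2) (derivFst X p (Y p).2)
  have h2 := map_sub (coSnd (β p)) (derivSnd Y p (X p).1) (derivSnd X p (Y p).1)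
  unfold coFstAlong coSndAlong derivFst derivSnd at *
  linear_combination - h1 - h2

theorem Bivector.apply_sharp_comm {W : Type*} [AddCommGroup W] [Module ℝ W] [TopologicalSpace W]
    [IsTopologicalAddGroup W] (P : Bivector W) (α β : W →L[ℝ] ℝ) :
    α (P.sharp β) = - β (P.sharp α) := by
  have h := P.alt (α + β)
  rw [map_add, map_add, add_apply, add_apply, P.alt,
    P.alt] at h
  linarith

/-- The direct sum of two bivector fields, on the product manifold. -/
def prodBivector (P : ∀ x : M, Bivector (TangentSpace I x))
    (S : ∀ q : Q, Bivector (TangentSpace J q)) (p : M × Q) :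
    Bivector (TangentSpace (I.prod J) p) :=
  (P p.1).prod (S p.2)

/-- The direct sum of two `(1,1)`-tensors, on the product manifold. -/
def prodEndo (N : ∀ x : M, TangentSpace I x →L[ℝ] TangentSpace I x)
    (T : ∀ q : Q, TangentSpace J q →L[ℝ] TangentSpace J q) (p : M × Q) :
    TangentSpace (I.prod J) p →L[ℝ] TangentSpace (I.prod J) p :=
  (N p.1).prodMap (T p.2)

section FormBracket

variable {P : ∀ x : M, Bivector (TangentSpace I x)} {S : ∀ q : Q, Bivector (TangentSpace J q)}

theorem chartDeriv_fstAlong_sharp {α : ∀ p : M × Q, TangentSpace (I.prod J) p →L[ℝ] ℝ}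
    (hα : SmoothForm (I.prod J) α) (x : M) (q : Q) (w : F) :
    chartDeriv J (fstAlong (fun p => (prodBivector P S p).sharp (α p)) x) q w =
      (P x).sharp (chartDeriv J (coFstAlong α x) q w) :=
  chartDeriv_clm_comp (V := E →L[ℝ] ℝ) (W := E)
    (show (E →L[ℝ] ℝ) →ₗ[ℝ] E from (P x).sharp).toContinuousLinearMap
    (hα.mdifferentiableAt_coFstAlong x q) w

theorem chartDeriv_sndAlong_sharp {α : ∀ p : M × Q, TangentSpace (I.prod J) p →L[ℝ] ℝ}
    (hα : SmoothForm (I.prod J) α) (x : M) (q : Q) (v : E) :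
    chartDeriv I (sndAlong (fun p => (prodBivector P S p).sharp (α p)) q) x v =
      (S q).sharp (chartDeriv I (coSndAlong α q) x v) :=
  chartDeriv_clm_comp (V := F →L[ℝ] ℝ) (W := F)
    (show (F →L[ℝ] ℝ) →ₗ[ℝ] F from (S q).sharp).toContinuousLinearMap
    (hα.mdifferentiableAt_coSndAlong q x) v

/-- The bracket of one-forms of a direct sum of bivector fields, split along the two factors. -/
theorem formBracket_prod {α β : ∀ p : M × Q, TangentSpace (I.prod J) p →L[ℝ] ℝ}
    (hα : SmoothForm (I.prod J) α) (hβ : SmoothForm (I.prod J) β)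
    (hPα : SmoothVF (I.prod J) (fun p => (prodBivector P S p).sharp (α p)))
    (hPβ : SmoothVF (I.prod J) (fun p => (prodBivector P S p).sharp (β p)))
    {Y : ∀ p : M × Q, TangentSpace (I.prod J) p} (hY : SmoothVF (I.prod J) Y) (p : M × Q) :
    formBracket (I.prod J) (fun y => (prodBivector P S y).sharp) α β Y p =
      (formBracket I (fun x => (P x).sharp) (fun x => coFst (α (x, p.2)))
          (fun x => coFst (β (x, p.2))) (fun x => (Y (x, p.2)).1) p.1
        + (chartDeriv J (coFstAlong β p.1) p.2 ((S p.2).sharp (coSnd (α p))) (Y p).1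
        - chartDeriv J (coFstAlong α p.1) p.2 ((S p.2).sharp (coSnd (β p))) (Y p).1))
      + (formBracket J (fun q => (S q).sharp) (fun q => coSnd (α (p.1, q)))
          (fun q => coSnd (β (p.1, q))) (fun q => (Y (p.1, q)).2) p.2
        + (chartDeriv I (coSndAlong β p.2) p.1 ((P p.1).sharp (coFst (α p))) (Y p).2
        - chartDeriv I (coSndAlong α p.2) p.1 ((P p.1).sharp (coFst (β p))) (Y p).2)) := by
  have g1 : formBracket I (fun x => (P x).sharp) (fun x => coFst (α (x, p.2)))
      (fun x => coFst (β (x, p.2))) (fun x => (Y (x, p.2)).1) p.1 =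
      lieDerivForm I (fun x => ((prodBivector P S (x, p.2)).sharp (α (x, p.2))).1)
          (fun x => coFst (β (x, p.2))) (fun x => (Y (x, p.2)).1) p.1
        - lieDerivForm I (fun x => ((prodBivector P S (x, p.2)).sharp (β (x, p.2))).1)
          (fun x => coFst (α (x, p.2))) (fun x => (Y (x, p.2)).1) p.1
        - dif I (fun x => coFst (β (x, p.2)) ((prodBivector P S (x, p.2)).sharp (α (x, p.2))).1) p.1
          (Y p).1 := rfl
  have g2 : formBracket J (fun q => (S q).sharp) (fun q => coSnd (α (p.1, q)))
      (fun q => coSnd (β (p.1, q))) (fun q => (Y (p.1, q)).2) p.2 =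
      lieDerivForm J (fun q => ((prodBivector P S (p.1, q)).sharp (α (p.1, q))).2)
          (fun q => coSnd (β (p.1, q))) (fun q => (Y (p.1, q)).2) p.2
        - lieDerivForm J (fun q => ((prodBivector P S (p.1, q)).sharp (β (p.1, q))).2)
          (fun q => coSnd (α (p.1, q))) (fun q => (Y (p.1, q)).2) p.2
        - dif J (fun q => coSnd (β (p.1, q)) ((prodBivector P S (p.1, q)).sharp (α (p.1, q))).2) p.2
          (Y p).2 := rfl
  rw [g1, g2, formBracket, lieDerivForm_prod hβ hPα hY, lieDerivForm_prod hα hPβ hY, dif_apply_prod hβ hPα]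
  rw [chartDeriv_fstAlong_sharp hα, chartDeriv_sndAlong_sharp hα, chartDeriv_fstAlong_sharp hβ,
    chartDeriv_sndAlong_sharp hβ]
  have h1 := (P p.1).apply_sharp_comm (coFst (α p))
    (chartDeriv J (coFstAlong β p.1) p.2 (Y p).2)
  have h2 := (S p.2).apply_sharp_comm (coSnd (α p))
    (chartDeriv I (coSndAlong β p.2) p.1 (Y p).1)
  have e1 : coFstAlong α p.1 p.2 = coFst (α p) := rfl
  have e2 : coSndAlong α p.2 p.1 = coSnd (α p) := rfl
  have e3 : ((prodBivector P S p).sharp (α p)).1 = (P p.1).sharp (coFst (α p)) := rfl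
  have e4 : ((prodBivector P S p).sharp (α p)).2 = (S p.2).sharp (coSnd (α p)) := rfl
  have e5 : ((prodBivector P S p).sharp (β p)).1 = (P p.1).sharp (coFst (β p)) := rfl
  have e6 : ((prodBivector P S p).sharp (β p)).2 = (S p.2).sharp (coSnd (β p)) := rfl
  rw [e1, e2, e3, e4, e5, e6]
  linear_combination -h1 - h2

end FormBracket
end Product

section ProductStructures
open Set Filter Topology

variable {E : Type*} [NormedAddCommGroup E] [NormedSpace ℝ E] [FiniteDimensional ℝ E]
  {H : Type*} [TopologicalSpace H]
  {I : ModelWithCorners ℝ E H} [I.Boundaryless] {M : Type*} [TopologicalSpace M] [ChartedSpace H M]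
  [IsManifold I ∞ M] [T2Space M]
  {F : Type*} [NormedAddCommGroup F] [NormedSpace ℝ F] [FiniteDimensional ℝ F]
  {K : Type*} [TopologicalSpace K]
  {J : ModelWithCorners ℝ F K} [J.Boundaryless] {Q : Type*} [TopologicalSpace Q] [ChartedSpace K Q]
  [IsManifold J ∞ Q] [T2Space Q]
  {V : Type*} [NormedAddCommGroup V] [NormedSpace ℝ V]

theorem SmoothVF.prod {A : ∀ x : M, TangentSpace I x} {B : ∀ q : Q, TangentSpace J q}
    (hA : SmoothVF I A) (hB : SmoothVF J B) :
    SmoothVF (I.prod J) (fun p : M × Q => ((A p.1, B p.2) : E × F)) :=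
  ContMDiff.tangentProdMk (ContMDiff.comp hA contMDiff_fst) (ContMDiff.comp hB contMDiff_snd)

theorem smoothVF_zero : SmoothVF I (fun x : M => (0 : TangentSpace I x)) :=
  contMDiff_tangent_zero contMDiff_id

/-! ### Nijenhuis tensors -/

section Nijenhuis

variable {N : ∀ x : M, TangentSpace I x →L[ℝ] TangentSpace I x}
  {T : ∀ q : Q, TangentSpace J q →L[ℝ] TangentSpace J q}

theorem SmoothEndo.prod (hN : SmoothEndo I N) (hT : SmoothEndo J T) :
    SmoothEndo (I.prod J) (prodEndo N T) :=
  ContMDiff.tangentProdMk (ContMDiff.comp hN contMDiff_tangent_fst)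
    (ContMDiff.comp hT contMDiff_tangent_snd)

theorem derivFst_prodEndo {X : ∀ p : M × Q, TangentSpace (I.prod J) p}
    (hX : SmoothVF (I.prod J) X) (p : M × Q) (w : TangentSpace J p.2) :
    derivFst (fun p => prodEndo N T p (X p)) p w = N p.1 (derivFst X p w) :=
  chartDeriv_clm_comp (V := E) (W := E) (show E →L[ℝ] E from N p.1)
    (hX.mdifferentiableAt_fstAlong p.1 p.2) w

theorem derivSnd_prodEndo {X : ∀ p : M × Q, TangentSpace (I.prod J) p}
    (hX : SmoothVF (I.prod J) X) (p : M × Q) (v : TangentSpace I p.1) :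
    derivSnd (fun p => prodEndo N T p (X p)) p v = T p.2 (derivSnd X p v) :=
  chartDeriv_clm_comp (V := F) (W := F) (show F →L[ℝ] F from T p.2)
    (hX.mdifferentiableAt_sndAlong p.2 p.1) v

theorem nijenhuisTorsion_prod_fst (hN : SmoothEndo I N) (hT : SmoothEndo J T)
    {X Y : ∀ p : M × Q, TangentSpace (I.prod J) p}
    (hX : SmoothVF (I.prod J) X) (hY : SmoothVF (I.prod J) Y) (p : M × Q) :
    (nijenhuisTorsion (I.prod J) (prodEndo N T) X Y p).1 =
      nijenhuisTorsion I N (fun x => (X (x, p.2)).1) (fun x => (Y (x, p.2)).1) p.1 := by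
  have hs := hN.prod hT
  have b1 := mlieBracket_prod_fst (hs.apply hX) (hs.apply hY) p
  have b2 := mlieBracket_prod_fst (hs.apply hX) hY p
  have b3 := mlieBracket_prod_fst hX (hs.apply hY) p
  have b4 := mlieBracket_prod_fst hX hY p
  rw [derivFst_prodEndo (N := N) (T := T) hX p (prodEndo N T p (Y p)).2,
    derivFst_prodEndo (N := N) (T := T) hY p (prodEndo N T p (X p)).2] at b1
  rw [derivFst_prodEndo (N := N) (T := T) hX p (Y p).2] at b2
  rw [derivFst_prodEndo (N := N) (T := T) hY p (X p).2] at b3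
  have g : nijenhuisTorsion I N (fun x => (X (x, p.2)).1) (fun x => (Y (x, p.2)).1) p.1 =
      VectorField.mlieBracket I (fun x => (prodEndo N T (x, p.2) (X (x, p.2))).1)
        (fun x => (prodEndo N T (x, p.2) (Y (x, p.2))).1) p.1
      - N p.1 (VectorField.mlieBracket I (fun x => (prodEndo N T (x, p.2) (X (x, p.2))).1)
        (fun x => (Y (x, p.2)).1) p.1)
      - N p.1 (VectorField.mlieBracket I (fun x => (X (x, p.2)).1)
        (fun x => (prodEndo N T (x, p.2) (Y (x, p.2))).1) p.1)
      + N p.1 (N p.1 (VectorField.mlieBracket I (fun x => (X (x, p.2)).1)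
        (fun x => (Y (x, p.2)).1) p.1)) := rfl
  have hsub : ∀ {a a' b b' : TangentSpace I p.1}, a = a' → b = b' → a - b = a' - b' := by
    rintro _ _ _ _ rfl rfl; rfl
  have hadd : ∀ {a a' b b' : TangentSpace I p.1}, a = a' → b = b' → a + b = a' + b' := by
    rintro _ _ _ _ rfl rfl; rfl
  refine (hadd (hsub (hsub b1 (congrArg (N p.1) b2)) (congrArg (N p.1) b3))
    (congrArg (fun v => N p.1 (N p.1 v)) b4)).trans ?_
  rw [g]
  simp only [map_add, map_sub]
  abel

theorem nijenhuisTorsion_prod_snd (hN : SmoothEndo I N) (hT : SmoothEndo J T)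
    {X Y : ∀ p : M × Q, TangentSpace (I.prod J) p}
    (hX : SmoothVF (I.prod J) X) (hY : SmoothVF (I.prod J) Y) (p : M × Q) :
    (nijenhuisTorsion (I.prod J) (prodEndo N T) X Y p).2 =
      nijenhuisTorsion J T (fun q => (X (p.1, q)).2) (fun q => (Y (p.1, q)).2) p.2 := by
  have hs := hN.prod hT
  have b1 := mlieBracket_prod_snd (hs.apply hX) (hs.apply hY) p
  have b2 := mlieBracket_prod_snd (hs.apply hX) hY p
  have b3 := mlieBracket_prod_snd hX (hs.apply hY) p
  have b4 := mlieBracket_prod_snd hX hY p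
  rw [derivSnd_prodEndo (N := N) (T := T) hX p (prodEndo N T p (Y p)).1,
    derivSnd_prodEndo (N := N) (T := T) hY p (prodEndo N T p (X p)).1] at b1
  rw [derivSnd_prodEndo (N := N) (T := T) hX p (Y p).1] at b2
  rw [derivSnd_prodEndo (N := N) (T := T) hY p (X p).1] at b3
  have g : nijenhuisTorsion J T (fun q => (X (p.1, q)).2) (fun q => (Y (p.1, q)).2) p.2 =
      VectorField.mlieBracket J (fun q => (prodEndo N T (p.1, q) (X (p.1, q))).2)
        (fun q => (prodEndo N T (p.1, q) (Y (p.1, q))).2) p.2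
      - T p.2 (VectorField.mlieBracket J (fun q => (prodEndo N T (p.1, q) (X (p.1, q))).2)
        (fun q => (Y (p.1, q)).2) p.2)
      - T p.2 (VectorField.mlieBracket J (fun q => (X (p.1, q)).2)
        (fun q => (prodEndo N T (p.1, q) (Y (p.1, q))).2) p.2)
      + T p.2 (T p.2 (VectorField.mlieBracket J (fun q => (X (p.1, q)).2)
        (fun q => (Y (p.1, q)).2) p.2)) := rfl
  have hsub : ∀ {a a' b b' : TangentSpace J p.2}, a = a' → b = b' → a - b = a' - b' := by
    rintro _ _ _ _ rfl rfl; rfl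
  have hadd : ∀ {a a' b b' : TangentSpace J p.2}, a = a' → b = b' → a + b = a' + b' := by
    rintro _ _ _ _ rfl rfl; rfl
  refine (hadd (hsub (hsub b1 (congrArg (T p.2) b2)) (congrArg (T p.2) b3))
    (congrArg (fun v => T p.2 (T p.2 v)) b4)).trans ?_
  rw [g]
  simp only [map_add, map_sub]
  abel

theorem IsNijenhuis.prod (hN : IsNijenhuis I N) (hT : IsNijenhuis J T) :
    IsNijenhuis (I.prod J) (prodEndo N T) :=
  ⟨hN.1.prod hT.1, fun _ _ hX hY p => Prod.ext
    ((nijenhuisTorsion_prod_fst hN.1 hT.1 hX hY p).trans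
      (hN.2 _ _ (hX.slice_fst p.2) (hY.slice_fst p.2) p.1))
    ((nijenhuisTorsion_prod_snd hN.1 hT.1 hX hY p).trans
      (hT.2 _ _ (hX.slice_snd p.1) (hY.slice_snd p.1) p.2))⟩

end Nijenhuis

/-! ### Poisson structures -/

section Poisson

variable {P : ∀ x : M, Bivector (TangentSpace I x)} {S : ∀ q : Q, Bivector (TangentSpace J q)}

theorem bivectorBracket_prod {f h : M × Q → ℝ} {p : M × Q}
    (hf : MDifferentiableAt (I.prod J) 𝓘(ℝ, ℝ) f p)
    (hh : MDifferentiableAt (I.prod J) 𝓘(ℝ, ℝ) h p) :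
    bivectorBracket (I.prod J) (prodBivector P S) f h p =
      bivectorBracket I P (fun x => f (x, p.2)) (fun x => h (x, p.2)) p.1
        + bivectorBracket J S (fun q => f (p.1, q)) (fun q => h (p.1, q)) p.2 := by
  unfold bivectorBracket Bivector.eval
  rw [← coFst_dif hf, ← coFst_dif hh, ← coSnd_dif hf, ← coSnd_dif hh]
  exact apply_eq_coFst_add_coSnd _ _

theorem SmoothBivector.smoothFun_slice_fst (hP : SmoothBivector I P) {f h : M × Q → ℝ}
    (hf : SmoothFun (I.prod J) f) (hh : SmoothFun (I.prod J) h) :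
    SmoothFun (I.prod J) (fun p : M × Q =>
      bivectorBracket I P (fun x => f (x, p.2)) (fun x => h (x, p.2)) p.1) := by
  intro p₀
  obtain ⟨φ, e, hφ, hes, he⟩ := exists_dual_frame I p₀.1
  have hd : ∀ {g : M × Q → ℝ}, SmoothFun (I.prod J) g → ∀ i,
      ContMDiffAt (I.prod J) 𝓘(ℝ, ℝ) ∞ (fun p => coFst (dif (I.prod J) g p) (e i p.1)) p₀ := by
    intro g hg i
    have h1 : ContMDiffAt (I.prod J) (I.prod J).tangent ∞ (fun p : M × Q =>
        (⟨(p.1, p.2), (e i p.1, 0)⟩ : TangentBundle (I.prod J) (M × Q))) p₀ :=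
      ContMDiffAt.tangentProdMk (ContMDiffAt.comp p₀ (hes i) contMDiffAt_fst)
        (contMDiff_tangent_zero contMDiff_snd).contMDiffAt
    exact ContMDiffAt.comp (g := fun v : TangentBundle (I.prod J) (M × Q) =>
      dif (I.prod J) g v.1 v.2) p₀ hg.smoothForm_dif.contMDiffAt h1
  have hsum : ContMDiffAt (I.prod J) 𝓘(ℝ, ℝ) ∞ (fun p : M × Q => ∑ i, ∑ j,
      coFst (dif (I.prod J) f p) (e i p.1) * (coFst (dif (I.prod J) h p) (e j p.1) *
        bivectorBracket I P (φ i) (φ j) p.1)) p₀ :=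
    contMDiffAt_finsetSum fun i _ => contMDiffAt_finsetSum fun j _ =>
      (hd hf i).mul ((hd hh j).mul
        (ContMDiffAt.comp p₀ (hP _ _ (hφ i) (hφ j)).contMDiffAt contMDiffAt_fst))
  refine hsum.congr_of_eventuallyEq ?_
  filter_upwards [continuousAt_fst.eventually he] with p hp
  rw [coFst_dif (hf.mdifferentiableAt p), coFst_dif (hh.mdifferentiableAt p)]
  exact (P p.1).eval_eq_sum hp _ _

theorem SmoothBivector.smoothFun_slice_snd (hS : SmoothBivector J S) {f h : M × Q → ℝ}
    (hf : SmoothFun (I.prod J) f) (hh : SmoothFun (I.prod J) h) :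
    SmoothFun (I.prod J) (fun p : M × Q =>
      bivectorBracket J S (fun q => f (p.1, q)) (fun q => h (p.1, q)) p.2) := by
  intro p₀
  obtain ⟨φ, e, hφ, hes, he⟩ := exists_dual_frame J p₀.2
  have hd : ∀ {g : M × Q → ℝ}, SmoothFun (I.prod J) g → ∀ i,
      ContMDiffAt (I.prod J) 𝓘(ℝ, ℝ) ∞ (fun p => coSnd (dif (I.prod J) g p) (e i p.2)) p₀ := by
    intro g hg i
    have h1 : ContMDiffAt (I.prod J) (I.prod J).tangent ∞ (fun p : M × Q =>
        (⟨(p.1, p.2), (0, e i p.2)⟩ : TangentBundle (I.prod J) (M × Q))) p₀ :=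
      ContMDiffAt.tangentProdMk (contMDiff_tangent_zero contMDiff_fst).contMDiffAt
        (ContMDiffAt.comp p₀ (hes i) contMDiffAt_snd)
    exact ContMDiffAt.comp (g := fun v : TangentBundle (I.prod J) (M × Q) =>
      dif (I.prod J) g v.1 v.2) p₀ hg.smoothForm_dif.contMDiffAt h1
  have hsum : ContMDiffAt (I.prod J) 𝓘(ℝ, ℝ) ∞ (fun p : M × Q => ∑ i, ∑ j,
      coSnd (dif (I.prod J) f p) (e i p.2) * (coSnd (dif (I.prod J) h p) (e j p.2) *
        bivectorBracket J S (φ i) (φ j) p.2)) p₀ :=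
    contMDiffAt_finsetSum fun i _ => contMDiffAt_finsetSum fun j _ =>
      (hd hf i).mul ((hd hh j).mul
        (ContMDiffAt.comp p₀ (hS _ _ (hφ i) (hφ j)).contMDiffAt contMDiffAt_snd))
  refine hsum.congr_of_eventuallyEq ?_
  filter_upwards [continuousAt_snd.eventually he] with p hp
  rw [coSnd_dif (hf.mdifferentiableAt p), coSnd_dif (hh.mdifferentiableAt p)]
  exact (S p.2).eval_eq_sum hp _ _

theorem SmoothBivector.prod (hP : SmoothBivector I P) (hS : SmoothBivector J S) :
    SmoothBivector (I.prod J) (prodBivector P S) := by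
  intro f h hf hh
  have e : bivectorBracket (I.prod J) (prodBivector P S) f h = fun p =>
      bivectorBracket I P (fun x => f (x, p.2)) (fun x => h (x, p.2)) p.1
        + bivectorBracket J S (fun q => f (p.1, q)) (fun q => h (p.1, q)) p.2 :=
    funext fun p => bivectorBracket_prod (hf.mdifferentiableAt p) (hh.mdifferentiableAt p)
  rw [e]
  exact ContMDiff.add (hP.smoothFun_slice_fst hf hh) (hS.smoothFun_slice_snd hf hh)

/-- Symmetry of the mixed second derivatives of a smooth function on a product. -/
theorem chartDeriv_coSndAlong_dif_comm {f : M × Q → ℝ} (hf : SmoothFun (I.prod J) f)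
    {A : ∀ x : M, TangentSpace I x} {B : ∀ q : Q, TangentSpace J q}
    (hA : SmoothVF I A) (hB : SmoothVF J B) (p : M × Q) :
    chartDeriv I (coSndAlong (dif (I.prod J) f) p.2) p.1 (A p.1) (B p.2) =
      chartDeriv J (coFstAlong (dif (I.prod J) f) p.1) p.2 (B p.2) (A p.1) := by
  have hX : SmoothVF (I.prod J) (fun p : M × Q => ((A p.1, (0 : F)) : E × F)) :=
    hA.prod smoothVF_zero
  have hY : SmoothVF (I.prod J) (fun p : M × Q => (((0 : E), B p.2) : E × F)) :=
    smoothVF_zero.prod hB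
  have h := dif_mlieBracket (x := p) hf.contMDiffAt (hX.mdifferentiableAt p)
    (hY.mdifferentiableAt p)
  have hzero : VectorField.mlieBracket (I.prod J) (fun p : M × Q => ((A p.1, (0 : F)) : E × F))
      (fun p : M × Q => (((0 : E), B p.2) : E × F)) p = 0 := by
    refine Prod.ext ((mlieBracket_prod_fst hX hY p).trans ?_)
      ((mlieBracket_prod_snd hX hY p).trans ?_)
    · have e1 : derivFst (I := I) (J := J) (fun p : M × Q => (((0 : E), B p.2) : E × F)) p (0 : F) = 0 :=
        map_zero (chartDeriv (V := E) J _ p.2)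
      have e2 : derivFst (I := I) (J := J) (fun p : M × Q => ((A p.1, (0 : F)) : E × F)) p (B p.2) = 0 :=
        congrArg (fun L : F →L[ℝ] E => L (B p.2)) (fderiv_const_apply (A p.1 : E))
      have e3 : VectorField.mlieBracket I A (fun x => (0 : TangentSpace I x)) p.1 = 0 :=
        congrFun (VectorField.mlieBracket_zero_right (I := I) (W := A)) p.1
      exact (congrArg₂ (· + ·) e3 (congrArg₂ (· - ·) e1 e2)).trans ((congrArg _ (sub_zero _)).trans (add_zero _))
    · have e1 : derivSnd (I := I) (J := J) (fun p : M × Q => ((A p.1, (0 : F)) : E × F)) p (0 : E) = 0 :=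
        map_zero (chartDeriv (V := F) I _ p.1)
      have e2 : derivSnd (I := I) (J := J) (fun p : M × Q => (((0 : E), B p.2) : E × F)) p (A p.1) = 0 :=
        congrArg (fun L : E →L[ℝ] F => L (A p.1)) (fderiv_const_apply (B p.2 : F))
      have e3 : VectorField.mlieBracket J (fun q => (0 : TangentSpace J q)) B p.2 = 0 :=
        congrFun (VectorField.mlieBracket_zero_left (I := J) (W := B)) p.2
      exact (congrArg₂ (· + ·) e3 (congrArg₂ (· - ·) e2 e1)).trans ((congrArg _ (sub_zero _)).trans (add_zero _))
  rw [hzero, map_zero] at h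
  have h1 : chartDeriv (I.prod J) (fun y : M × Q => dif (I.prod J) f y (((0 : E), B y.2) : E × F)) p
      ((A p.1, (0 : F)) : E × F) =
      chartDeriv I (coSndAlong (dif (I.prod J) f) p.2) p.1 (A p.1) (B p.2) := by
    refine (chartDeriv_prod_apply ((hf.smoothForm_dif.apply hY).mdifferentiableAt p) _).trans ?_
    refine (congrArg₂ (· + ·) ?_ (map_zero (chartDeriv J _ p.2))).trans (add_zero _)
    exact chartDeriv_clm_comp (V := F →L[ℝ] ℝ) (ContinuousLinearMap.apply ℝ ℝ (B p.2 : F))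
      (hf.smoothForm_dif.mdifferentiableAt_coSndAlong p.2 p.1) (A p.1)
  have h2 : chartDeriv (I.prod J) (fun y : M × Q => dif (I.prod J) f y ((A y.1, (0 : F)) : E × F)) p
      (((0 : E), B p.2) : E × F) =
      chartDeriv J (coFstAlong (dif (I.prod J) f) p.1) p.2 (B p.2) (A p.1) := by
    refine (chartDeriv_prod_apply ((hf.smoothForm_dif.apply hX).mdifferentiableAt p) _).trans ?_
    refine (congrArg₂ (· + ·) (map_zero (chartDeriv I _ p.1)) ?_).trans (zero_add _)
    exact chartDeriv_clm_comp (V := E →L[ℝ] ℝ) (ContinuousLinearMap.apply ℝ ℝ (A p.1 : E))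
      (hf.smoothForm_dif.mdifferentiableAt_coFstAlong p.1 p.2) (B p.2)
  linarith

theorem bivectorBracket_eq_neg_dif (a c : M → ℝ) (x : M) :
    bivectorBracket I P a c x = - dif I a x ((P x).sharp (dif I c x)) := by
  rw [Bivector.apply_sharp_comm, neg_neg]
  rfl

theorem dif_bivectorBracket_slice_fst (hP : SmoothBivector I P) (hS : SmoothBivector J S)
    {f g : M × Q → ℝ} (hf : SmoothFun (I.prod J) f) (hg : SmoothFun (I.prod J) g) (p : M × Q)
    (v : TangentSpace I p.1) :
    dif I (fun x => bivectorBracket (I.prod J) (prodBivector P S) f g (x, p.2)) p.1 v =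
      dif I (bivectorBracket I P (fun x => f (x, p.2)) (fun x => g (x, p.2))) p.1 v
        + (chartDeriv I (coSndAlong (dif (I.prod J) g) p.2) p.1 v
            ((S p.2).sharp (coSnd (dif (I.prod J) f p)))
          - chartDeriv I (coSndAlong (dif (I.prod J) f) p.2) p.1 v
            ((S p.2).sharp (coSnd (dif (I.prod J) g p)))) := by
  have hB := ((hP.prod hS) _ _ hf hg).slice_fst p.2
  have hB1 := hP _ _ (hf.slice_fst p.2) (hg.slice_fst p.2)
  have hdf := hf.smoothForm_dif.mdifferentiableAt_coSndAlong p.2 p.1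
  have hdg := hg.smoothForm_dif.mdifferentiableAt_coSndAlong p.2 p.1
  let L : (F →L[ℝ] ℝ) →L[ℝ] F :=
    (show (F →L[ℝ] ℝ) →ₗ[ℝ] F from (S p.2).sharp).toContinuousLinearMap
  have hL : MDifferentiableAt I 𝓘(ℝ, F)
      (fun x => L (coSndAlong (dif (I.prod J) f) p.2 x)) p.1 :=
    L.mdifferentiableAt.comp p.1 hdf
  have e : (fun x => bivectorBracket (I.prod J) (prodBivector P S) f g (x, p.2)) = fun x =>
      bivectorBracket I P (fun x => f (x, p.2)) (fun x => g (x, p.2)) x +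
        coSndAlong (dif (I.prod J) g) p.2 x (L (coSndAlong (dif (I.prod J) f) p.2 x)) := by
    funext x
    rw [bivectorBracket_prod (hf.mdifferentiableAt _) (hg.mdifferentiableAt _)]
    unfold coSndAlong
    rw [coSnd_dif (hf.mdifferentiableAt _), coSnd_dif (hg.mdifferentiableAt _)]
    rfl
  rw [dif_eq_chartDeriv (hB.mdifferentiableAt p.1), dif_eq_chartDeriv (hB1.mdifferentiableAt p.1),
    e]
  refine (chartDeriv_add (hB1.mdifferentiableAt p.1) (hdg.clm_apply hL) v).trans ?_
  congr 1
  refine (chartDeriv_clm_apply hdg hL v).trans ?_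
  refine (congrArg (_ + ·) ((congrArg _ (chartDeriv_clm_comp L hdf v)).trans
    ((S p.2).apply_sharp_comm _ _))).trans (sub_eq_add_neg _ _).symm

theorem dif_bivectorBracket_slice_snd (hP : SmoothBivector I P) (hS : SmoothBivector J S)
    {f g : M × Q → ℝ} (hf : SmoothFun (I.prod J) f) (hg : SmoothFun (I.prod J) g) (p : M × Q)
    (w : TangentSpace J p.2) :
    dif J (fun q => bivectorBracket (I.prod J) (prodBivector P S) f g (p.1, q)) p.2 w =
      dif J (bivectorBracket J S (fun q => f (p.1, q)) (fun q => g (p.1, q))) p.2 w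
        + (chartDeriv J (coFstAlong (dif (I.prod J) g) p.1) p.2 w
            ((P p.1).sharp (coFst (dif (I.prod J) f p)))
          - chartDeriv J (coFstAlong (dif (I.prod J) f) p.1) p.2 w
            ((P p.1).sharp (coFst (dif (I.prod J) g p)))) := by
  have hB := ((hP.prod hS) _ _ hf hg).slice_snd p.1
  have hB1 := hS _ _ (hf.slice_snd p.1) (hg.slice_snd p.1)
  have hdf := hf.smoothForm_dif.mdifferentiableAt_coFstAlong p.1 p.2
  have hdg := hg.smoothForm_dif.mdifferentiableAt_coFstAlong p.1 p.2
  let L : (E →L[ℝ] ℝ) →L[ℝ] E :=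
    (show (E →L[ℝ] ℝ) →ₗ[ℝ] E from (P p.1).sharp).toContinuousLinearMap
  have hL : MDifferentiableAt J 𝓘(ℝ, E)
      (fun q => L (coFstAlong (dif (I.prod J) f) p.1 q)) p.2 :=
    L.mdifferentiableAt.comp p.2 hdf
  have e : (fun q => bivectorBracket (I.prod J) (prodBivector P S) f g (p.1, q)) = fun q =>
      bivectorBracket J S (fun q => f (p.1, q)) (fun q => g (p.1, q)) q +
        coFstAlong (dif (I.prod J) g) p.1 q (L (coFstAlong (dif (I.prod J) f) p.1 q)) := by
    funext q
    rw [bivectorBracket_prod (hf.mdifferentiableAt _) (hg.mdifferentiableAt _), add_comm]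
    unfold coFstAlong
    rw [coFst_dif (hf.mdifferentiableAt _), coFst_dif (hg.mdifferentiableAt _)]
    rfl
  rw [dif_eq_chartDeriv (hB.mdifferentiableAt p.2), dif_eq_chartDeriv (hB1.mdifferentiableAt p.2),
    e]
  refine (chartDeriv_add (hB1.mdifferentiableAt p.2) (hdg.clm_apply hL) w).trans ?_
  congr 1
  refine (chartDeriv_clm_apply hdg hL w).trans ?_
  refine (congrArg (_ + ·) ((congrArg _ (chartDeriv_clm_comp L hdf w)).trans
    ((P p.1).apply_sharp_comm _ _))).trans (sub_eq_add_neg _ _).symm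

/-- An iterated bracket on a product, split along the two factors. -/
theorem bivectorBracket_bivectorBracket_prod (hP : SmoothBivector I P) (hS : SmoothBivector J S)
    {f g h : M × Q → ℝ} (hf : SmoothFun (I.prod J) f) (hg : SmoothFun (I.prod J) g)
    (hh : SmoothFun (I.prod J) h) (p : M × Q) :
    bivectorBracket (I.prod J) (prodBivector P S)
        (bivectorBracket (I.prod J) (prodBivector P S) f g) h p =
      bivectorBracket I P (bivectorBracket I P (fun x => f (x, p.2)) (fun x => g (x, p.2)))
          (fun x => h (x, p.2)) p.1
        + bivectorBracket J S (bivectorBracket J S (fun q => f (p.1, q)) (fun q => g (p.1, q)))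
          (fun q => h (p.1, q)) p.2
        + (chartDeriv I (coSndAlong (dif (I.prod J) f) p.2) p.1
              ((P p.1).sharp (coFst (dif (I.prod J) h p))) ((S p.2).sharp (coSnd (dif (I.prod J) g p)))
            - chartDeriv I (coSndAlong (dif (I.prod J) g) p.2) p.1
              ((P p.1).sharp (coFst (dif (I.prod J) h p))) ((S p.2).sharp (coSnd (dif (I.prod J) f p))))
        + (chartDeriv J (coFstAlong (dif (I.prod J) f) p.1) p.2
              ((S p.2).sharp (coSnd (dif (I.prod J) h p))) ((P p.1).sharp (coFst (dif (I.prod J) g p)))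
            - chartDeriv J (coFstAlong (dif (I.prod J) g) p.1) p.2
              ((S p.2).sharp (coSnd (dif (I.prod J) h p)))
              ((P p.1).sharp (coFst (dif (I.prod J) f p)))) := by
  rw [bivectorBracket_prod (((hP.prod hS) _ _ hf hg).mdifferentiableAt p) (hh.mdifferentiableAt p),
    bivectorBracket_eq_neg_dif, bivectorBracket_eq_neg_dif,
    dif_bivectorBracket_slice_fst hP hS hf hg, dif_bivectorBracket_slice_snd hP hS hf hg,
    bivectorBracket_eq_neg_dif (P := P) (bivectorBracket I P _ _),
    bivectorBracket_eq_neg_dif (P := S) (bivectorBracket J S _ _),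
    coFst_dif (hh.mdifferentiableAt p), coSnd_dif (hh.mdifferentiableAt p)]
  ring

theorem IsPoisson.prod (hP : IsPoisson I P) (hS : IsPoisson J S) :
    IsPoisson (I.prod J) (prodBivector P S) := by
  refine ⟨hP.1.prod hS.1, fun f g h hf hg hh p => ?_⟩
  have h1 := hP.2 _ _ _ (hf.slice_fst p.2) (hg.slice_fst p.2) (hh.slice_fst p.2) p.1
  have h2 := hS.2 _ _ _ (hf.slice_snd p.1) (hg.slice_snd p.1) (hh.slice_snd p.1) p.2
  have hsym : ∀ {u v w : M × Q → ℝ}, SmoothFun (I.prod J) u → SmoothFun (I.prod J) v →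
      SmoothFun (I.prod J) w →
      chartDeriv I (coSndAlong (dif (I.prod J) u) p.2) p.1
        ((P p.1).sharp (coFst (dif (I.prod J) v p))) ((S p.2).sharp (coSnd (dif (I.prod J) w p))) =
      chartDeriv J (coFstAlong (dif (I.prod J) u) p.1) p.2
        ((S p.2).sharp (coSnd (dif (I.prod J) w p))) ((P p.1).sharp (coFst (dif (I.prod J) v p))) :=
    fun hu hv hw => chartDeriv_coSndAlong_dif_comm hu
      (hP.1.smoothVF_sharp (hv.smoothForm_dif.slice_fst p.2))
      (hS.1.smoothVF_sharp (hw.smoothForm_dif.slice_snd p.1)) p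
  simp only [schoutenBracket] at h1 h2 ⊢
  rw [bivectorBracket_bivectorBracket_prod hP.1 hS.1 hf hg hh,
    bivectorBracket_bivectorBracket_prod hP.1 hS.1 hg hh hf,
    bivectorBracket_bivectorBracket_prod hP.1 hS.1 hh hf hg,
    hsym hf hh hg, hsym hg hh hf, hsym hg hf hh, hsym hh hf hg, hsym hh hg hf, hsym hf hg hh]
  linear_combination h1 + h2

end Poisson

end ProductStructures

section ProductPN
open Set Filter Topology

/-- The bivector `n ∘ P♯`, for an endomorphism `n` with `n ∘ P♯ = P♯ ∘ n*`. -/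
def Bivector.comp {W : Type*} [AddCommGroup W] [Module ℝ W] [TopologicalSpace W]
    [IsTopologicalAddGroup W] (P : Bivector W) (n : W →L[ℝ] W)
    (h : ∀ ξ : W →L[ℝ] ℝ, n (P.sharp ξ) = P.sharp (ξ.comp n)) : Bivector W where
  sharp := n.toLinearMap ∘ₗ P.sharp
  alt α := by
    have h1 := P.apply_sharp_comm α (α.comp n)
    rw [← h α] at h1
    have h2 : (α.comp n) (P.sharp α) = α (n (P.sharp α)) := rfl
    have h3 : α ((n.toLinearMap ∘ₗ P.sharp) α) = α (n (P.sharp α)) := rfl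
    rw [h3]
    linarith

variable {E : Type*} [NormedAddCommGroup E] [NormedSpace ℝ E] [FiniteDimensional ℝ E]
  {H : Type*} [TopologicalSpace H]
  {I : ModelWithCorners ℝ E H} [I.Boundaryless] {M : Type*} [TopologicalSpace M] [ChartedSpace H M]
  [IsManifold I ∞ M] [T2Space M]
  {F : Type*} [NormedAddCommGroup F] [NormedSpace ℝ F] [FiniteDimensional ℝ F]
  {K : Type*} [TopologicalSpace K]
  {J : ModelWithCorners ℝ F K} [J.Boundaryless] {Q : Type*} [TopologicalSpace Q] [ChartedSpace K Q]
  [IsManifold J ∞ Q] [T2Space Q]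
  {P : ∀ x : M, Bivector (TangentSpace I x)} {S : ∀ q : Q, Bivector (TangentSpace J q)}
  {N : ∀ x : M, TangentSpace I x →L[ℝ] TangentSpace I x}
  {T : ∀ q : Q, TangentSpace J q →L[ℝ] TangentSpace J q}

theorem coFst_comp_prodEndo {p : M × Q} (ξ : TangentSpace (I.prod J) p →L[ℝ] ℝ) :
    coFst (ξ.comp (prodEndo N T p)) = (coFst ξ).comp (N p.1) := by
  refine ContinuousLinearMap.ext fun v => ?_
  exact congrArg (fun z : F => ξ ((N p.1 v, z) : E × F)) (map_zero (T p.2))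

theorem coSnd_comp_prodEndo {p : M × Q} (ξ : TangentSpace (I.prod J) p →L[ℝ] ℝ) :
    coSnd (ξ.comp (prodEndo N T p)) = (coSnd ξ).comp (T p.2) := by
  refine ContinuousLinearMap.ext fun v => ?_
  exact congrArg (fun z : E => ξ ((z, T p.2 v) : E × F)) (map_zero (N p.1))

theorem chartDeriv_coFstAlong_comp {α : ∀ p : M × Q, TangentSpace (I.prod J) p →L[ℝ] ℝ}
    (hα : SmoothForm (I.prod J) α) (x : M) (q : Q) (w : TangentSpace J q) (v : TangentSpace I x) :
    chartDeriv J (coFstAlong (fun p => (α p).comp (prodEndo N T p)) x) q w v =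
      chartDeriv J (coFstAlong α x) q w (N x v) := by
  have e : coFstAlong (fun p => (α p).comp (prodEndo N T p)) x = fun q =>
      (ContinuousLinearMap.compL ℝ E E ℝ).flip (N x) (coFstAlong α x q) :=
    funext fun q => coFst_comp_prodEndo (α (x, q))
  rw [e]
  exact congrArg (fun L : E →L[ℝ] ℝ => L v) (chartDeriv_clm_comp (V := E →L[ℝ] ℝ)
    ((ContinuousLinearMap.compL ℝ E E ℝ).flip (N x)) (hα.mdifferentiableAt_coFstAlong x q) w)

theorem chartDeriv_coSndAlong_comp {α : ∀ p : M × Q, TangentSpace (I.prod J) p →L[ℝ] ℝ}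
    (hα : SmoothForm (I.prod J) α) (x : M) (q : Q) (v : TangentSpace I x) (w : TangentSpace J q) :
    chartDeriv I (coSndAlong (fun p => (α p).comp (prodEndo N T p)) q) x v w =
      chartDeriv I (coSndAlong α q) x v (T q w) := by
  have e : coSndAlong (fun p => (α p).comp (prodEndo N T p)) q = fun x =>
      (ContinuousLinearMap.compL ℝ F F ℝ).flip (T q) (coSndAlong α q x) :=
    funext fun x => coSnd_comp_prodEndo (α (x, q))
  rw [e]
  exact congrArg (fun L : F →L[ℝ] ℝ => L w) (chartDeriv_clm_comp (V := F →L[ℝ] ℝ)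
    ((ContinuousLinearMap.compL ℝ F F ℝ).flip (T q)) (hα.mdifferentiableAt_coSndAlong q x) v)

/-- The concomitant of a direct sum, split along the two factors. -/
theorem concomitant_prod (hP : SmoothBivector I P) (hS : SmoothBivector J S)
    (hN : SmoothEndo I N) (hT : SmoothEndo J T)
    (hNP : ∀ x ξ, N x ((P x).sharp ξ) = (P x).sharp (ξ.comp (N x)))
    (hTS : ∀ q ξ, T q ((S q).sharp ξ) = (S q).sharp (ξ.comp (T q)))
    {α β : ∀ p : M × Q, TangentSpace (I.prod J) p →L[ℝ] ℝ}
    (hα : SmoothForm (I.prod J) α) (hβ : SmoothForm (I.prod J) β)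
    {Y : ∀ p : M × Q, TangentSpace (I.prod J) p} (hY : SmoothVF (I.prod J) Y) (p : M × Q) :
    concomitant (I.prod J) (prodBivector P S) (prodEndo N T) α β Y p =
      concomitant I P N (fun x => coFst (α (x, p.2))) (fun x => coFst (β (x, p.2)))
          (fun x => (Y (x, p.2)).1) p.1
        + concomitant J S T (fun q => coSnd (α (p.1, q))) (fun q => coSnd (β (p.1, q)))
          (fun q => (Y (p.1, q)).2) p.2 := by
  have hPS := hP.prod hS
  have hNT := hN.prod hT
  have hαN := hα.comp hNT
  have hβN := hβ.comp hNT
  have e1 : formBracket (I.prod J) (fun y ξ => prodEndo N T y ((prodBivector P S y).sharp ξ))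
      α β Y p = _ :=
    formBracket_prod (P := fun x => (P x).comp (N x) (hNP x))
      (S := fun q => (S q).comp (T q) (hTS q)) hα hβ
      (hNT.apply (hPS.smoothVF_sharp hα)) (hNT.apply (hPS.smoothVF_sharp hβ)) hY p
  have e2 := formBracket_prod hαN hβ (hPS.smoothVF_sharp hαN) (hPS.smoothVF_sharp hβ) hY p
  have e3 := formBracket_prod hα hβN (hPS.smoothVF_sharp hα) (hPS.smoothVF_sharp hβN) hY p
  have e4 := formBracket_prod hα hβ (hPS.smoothVF_sharp hα) (hPS.smoothVF_sharp hβ)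
    (hNT.apply hY) p
  simp only [coFst_comp_prodEndo, coSnd_comp_prodEndo] at e2 e3
  rw [chartDeriv_coFstAlong_comp (N := N) (T := T) hα p.1 p.2 ((S p.2).sharp (coSnd (β p))) (Y p).1,
    chartDeriv_coSndAlong_comp (N := N) (T := T) hα p.1 p.2 ((P p.1).sharp (coFst (β p))) (Y p).2,
    ← hNP p.1 (coFst (α p)), ← hTS p.2 (coSnd (α p))] at e2
  rw [chartDeriv_coFstAlong_comp (N := N) (T := T) hβ p.1 p.2 ((S p.2).sharp (coSnd (α p))) (Y p).1,
    chartDeriv_coSndAlong_comp (N := N) (T := T) hβ p.1 p.2 ((P p.1).sharp (coFst (α p))) (Y p).2,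
    ← hNP p.1 (coFst (β p)), ← hTS p.2 (coSnd (β p))] at e3
  unfold concomitant
  rw [e1, e2, e3, e4]
  have r1 : ∀ ξ, ((P p.1).comp (N p.1) (hNP p.1)).sharp ξ = N p.1 ((P p.1).sharp ξ) :=
    fun _ => rfl
  have r2 : ∀ ξ, ((S p.2).comp (T p.2) (hTS p.2)).sharp ξ = T p.2 ((S p.2).sharp ξ) :=
    fun _ => rfl
  have r3 : (prodEndo N T p (Y p)).1 = N p.1 (Y p).1 := rfl
  have r4 : (prodEndo N T p (Y p)).2 = T p.2 (Y p).2 := rfl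
  have r5 : formBracket I (fun x => ((P x).comp (N x) (hNP x)).sharp)
      (fun x => coFst (α (x, p.2))) (fun x => coFst (β (x, p.2))) (fun x => (Y (x, p.2)).1) p.1 =
      formBracket I (fun x ξ => N x ((P x).sharp ξ))
      (fun x => coFst (α (x, p.2))) (fun x => coFst (β (x, p.2))) (fun x => (Y (x, p.2)).1) p.1 :=
    rfl
  have r6 : formBracket J (fun q => ((S q).comp (T q) (hTS q)).sharp)
      (fun q => coSnd (α (p.1, q))) (fun q => coSnd (β (p.1, q))) (fun q => (Y (p.1, q)).2) p.2 =
      formBracket J (fun q ξ => T q ((S q).sharp ξ))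
      (fun q => coSnd (α (p.1, q))) (fun q => coSnd (β (p.1, q))) (fun q => (Y (p.1, q)).2) p.2 :=
    rfl
  have r7 : formBracket I (fun x => (P x).sharp)
      (fun x => coFst (α (x, p.2))) (fun x => coFst (β (x, p.2)))
      (fun x => (prodEndo N T (x, p.2) (Y (x, p.2))).1) p.1 =
      formBracket I (fun x => (P x).sharp)
      (fun x => coFst (α (x, p.2))) (fun x => coFst (β (x, p.2)))
      (fun x => N x (Y (x, p.2)).1) p.1 := rfl
  have r8 : formBracket J (fun q => (S q).sharp)
      (fun q => coSnd (α (p.1, q))) (fun q => coSnd (β (p.1, q)))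
      (fun q => (prodEndo N T (p.1, q) (Y (p.1, q))).2) p.2 =
      formBracket J (fun q => (S q).sharp)
      (fun q => coSnd (α (p.1, q))) (fun q => coSnd (β (p.1, q)))
      (fun q => T q (Y (p.1, q)).2) p.2 := rfl
  rw [r1, r1, r2, r2, r3, r4, r5, r6, r7, r8]
  ring

/-- The product of two Poisson–Nijenhuis manifolds. -/
theorem IsPoissonNijenhuis.prod (hM : IsPoissonNijenhuis I P N) (hQ : IsPoissonNijenhuis J S T) :
    IsPoissonNijenhuis (I.prod J) (prodBivector P S) (prodEndo N T) where
  poisson := hM.poisson.prod hQ.poisson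
  nijenhuis := hM.nijenhuis.prod hQ.nijenhuis
  comm p ξ := by
    have h1 := (hM.comm p.1 (coFst ξ)).trans
      (congrArg (P p.1).sharp (coFst_comp_prodEndo (N := N) (T := T) ξ).symm)
    have h2 := (hQ.comm p.2 (coSnd ξ)).trans
      (congrArg (S p.2).sharp (coSnd_comp_prodEndo (N := N) (T := T) ξ).symm)
    exact Prod.ext h1 h2
  concomitant_eq_zero α β hα hβ Y hY p := by
    rw [concomitant_prod hM.poisson.1 hQ.poisson.1 hM.nijenhuis.1 hQ.nijenhuis.1 hM.comm hQ.comm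
      hα hβ hY p,
      hM.concomitant_eq_zero _ _ (hα.slice_fst p.2) (hβ.slice_fst p.2) _ (hY.slice_fst p.2),
      hQ.concomitant_eq_zero _ _ (hα.slice_snd p.1) (hβ.slice_snd p.1) _ (hY.slice_snd p.1),
      add_zero]

theorem dif_zero (x : M) : dif I (fun _ : M => (0 : ℝ)) x = 0 := mfderiv_const

theorem formBracket_zero (α β : ∀ x : M, TangentSpace I x →L[ℝ] ℝ) (Y : ∀ x : M, TangentSpace I x)
    (x : M) : formBracket I (fun _ _ => 0) α β Y x = 0 := by
  have h : VectorField.mlieBracket I (fun x : M => (0 : TangentSpace I x)) Y x = 0 :=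
    congrFun VectorField.mlieBracket_zero_left x
  simp only [formBracket, lieDerivForm, map_zero, h, dif_zero, sub_self]
  simp

/-- The zero Poisson–Nijenhuis structure. -/
theorem isPoissonNijenhuis_zero :
    IsPoissonNijenhuis I (fun x : M => (Bivector.zero : Bivector (TangentSpace I x)))
      (fun _ => 0) := by
  have hb : ∀ f g : M → ℝ, bivectorBracket I
      (fun x : M => (Bivector.zero : Bivector (TangentSpace I x))) f g = fun _ => 0 :=
    fun f g => funext fun x => map_zero (dif I g x)
  refine ⟨⟨fun f g _ _ => ?_, fun f g h _ _ _ x => ?_⟩, ⟨?_, fun X Y _ _ x => ?_⟩,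
    fun x ξ => rfl, fun α β _ _ Y _ x => ?_⟩
  · rw [hb]; exact contMDiff_const
  · simp [schoutenBracket, hb]
  · exact contMDiff_tangent_zero (Bundle.contMDiff_proj (TangentSpace I))
  · have h1 : ∀ Z : (∀ x : M, TangentSpace I x),
        VectorField.mlieBracket I (fun x : M => (0 : TangentSpace I x)) Z x = 0 :=
      fun _ => congrFun VectorField.mlieBracket_zero_left x
    have h2 : nijenhuisTorsion I (fun x : M => (0 : TangentSpace I x →L[ℝ] TangentSpace I x)) X Y x
      = VectorField.mlieBracket I (fun x : M => (0 : TangentSpace I x)) (fun _ => 0) x - 0 - 0 + 0 :=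
      rfl
    rw [h2, h1]; simp
  · have h0 := formBracket_zero (I := I) (M := M)
    have e : concomitant I (fun x : M => (Bivector.zero : Bivector (TangentSpace I x)))
      (fun _ => 0) α β Y x = formBracket I (fun _ _ => 0) α β Y x -
      (formBracket I (fun _ _ => 0) (fun y => (α y).comp 0) β Y x
      + formBracket I (fun _ _ => 0) α (fun y => (β y).comp 0) Y x
      - formBracket I (fun _ _ => 0) α β (fun y => 0) x) := rfl
    rw [e, h0, h0, h0, h0]; simp

end ProductPN

section TrivialGroupoid
open Set Filter Topology

theorem Bivector.ext_sharp {W : Type*} [AddCommGroup W] [Module ℝ W] [TopologicalSpace W]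
    {P Q : Bivector W} (h : ∀ ξ, P.sharp ξ = Q.sharp ξ) : P = Q := by
  obtain ⟨p, _⟩ := P
  obtain ⟨q, _⟩ := Q
  obtain rfl : p = q := LinearMap.ext h
  rfl

variable {E : Type*} [NormedAddCommGroup E] [NormedSpace ℝ E] [FiniteDimensional ℝ E]
  {H : Type*} [TopologicalSpace H]
  {I : ModelWithCorners ℝ E H} [I.Boundaryless] {M : Type*} [TopologicalSpace M] [ChartedSpace H M]
  [IsManifold I ∞ M] [T2Space M]
  {F : Type*} [NormedAddCommGroup F] [NormedSpace ℝ F] [FiniteDimensional ℝ F]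
  {K : Type*} [TopologicalSpace K]
  {J : ModelWithCorners ℝ F K} [J.Boundaryless] {G : Type*} [TopologicalSpace G] [ChartedSpace K G]
  [Group G] [LieGroup J ∞ G] [T2Space G]
  {PM : ∀ x : M, Bivector (TangentSpace I x)} {PG : ∀ a : G, Bivector (TangentSpace J a)}
  {NM : ∀ x : M, TangentSpace I x →L[ℝ] TangentSpace I x}
  {NG : ∀ a : G, TangentSpace J a →L[ℝ] TangentSpace J a}

theorem tripleBivector_eq_prodBivector : tripleBivector I J PM PG =
    prodBivector PM (prodBivector PG
      (fun x : M => (Bivector.zero : Bivector (TangentSpace I x)))) :=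
  funext fun _ => Bivector.ext_sharp fun _ => rfl

theorem tripleEndo_eq_prodEndo : tripleEndo I J NM NG =
    prodEndo NM (prodEndo NG (fun _ : M => 0)) :=
  rfl

/-- The direct sum `(P_M ⊕ P_G ⊕ 0, N_M ⊕ N_G ⊕ 0)` is a Poisson–Nijenhuis structure. -/
theorem IsPoissonNijenhuis.triple (hM : IsPoissonNijenhuis I PM NM)
    (hG : IsPoissonNijenhuis J PG NG) :
    IsPoissonNijenhuis (I.prod (J.prod I)) (tripleBivector I J PM PG) (tripleEndo I J NM NG) := by
  rw [tripleBivector_eq_prodBivector, tripleEndo_eq_prodEndo]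
  exact hM.prod (hG.prod isPoissonNijenhuis_zero)

/-- The derivative of a right translation of the trivial groupoid along the source fibre. -/
theorem mfderivWithin_rightTrans_apply (g p : M × G × M) (hp : p.2.2 = g.1)
    (X : TangentSpace I p.1) (V : TangentSpace J p.2.1) :
    mfderivWithin (I.prod (J.prod I)) (I.prod (J.prod I))
        ((trivialGroupoid I M J G).rightTrans g) ((trivialGroupoid I M J G).rightDomain g) p
        (tangentTriple I J p (X, V, 0)) =
      ((X, mfderiv J J (fun b : G => b * g.2.1) p.2.1 V, 0) : E × F × E) := by
  obtain ⟨x, b, y⟩ := p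
  dsimp only at hp X V
  have hmul : ContMDiff J J ∞ (fun b : G => b * g.2.1) := contMDiff_id.mul contMDiff_const
  have hR : ContMDiff (I.prod (J.prod I)) (I.prod (J.prod I)) ∞
      ((trivialGroupoid I M J G).rightTrans g) :=
    contMDiff_fst.prodMk ((hmul.comp (contMDiff_fst.comp contMDiff_snd)).prodMk contMDiff_const)
  have hW : HasMFDerivWithinAt (I.prod (J.prod I)) (I.prod (J.prod I))
      ((trivialGroupoid I M J G).rightTrans g) ((trivialGroupoid I M J G).rightDomain g) (x, b, y)
      (mfderivWithin (I.prod (J.prod I)) (I.prod (J.prod I))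
        ((trivialGroupoid I M J G).rightTrans g) ((trivialGroupoid I M J G).rightDomain g)
        (x, b, y)) :=
    ((hR.mdifferentiable (by simp)) (x, b, y)).mdifferentiableWithinAt.hasMFDerivWithinAt
  have hι : HasMFDerivAt (I.prod J) (I.prod (J.prod I)) (fun q : M × G => (q.1, q.2, y)) (x, b)
      ((ContinuousLinearMap.fst ℝ E F).prod ((ContinuousLinearMap.snd ℝ E F).prod 0)) :=
    (hasMFDerivAt_fst (x, b)).prodMk
      ((hasMFDerivAt_snd (x, b)).prodMk (hasMFDerivAt_const y (x, b)))
  have hcomp : HasMFDerivAt (I.prod J) (I.prod (J.prod I))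
      (fun q : M × G => (q.1, q.2 * g.2.1, g.2.2)) (x, b) _ :=
    (hasMFDerivAt_fst (x, b)).prodMk
      ((((hmul.mdifferentiable (by simp) b).hasMFDerivAt).comp (x, b)
        (hasMFDerivAt_snd (x, b))).prodMk (hasMFDerivAt_const g.2.2 (x, b)))
  have h := hW.comp (x, b) hι.hasMFDerivWithinAt 
    (show univ ⊆ (fun q : M × G => (q.1, q.2, y)) ⁻¹' (trivialGroupoid I M J G).rightDomain g from
      fun _ _ => hp)
  rw [hasMFDerivWithinAt_univ] at h
  exact congrArg (fun L : E × F →L[ℝ] E × F × E => L (X, V)) (hasMFDerivAt_unique h hcomp)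

theorem dRight_trivialGroupoid (g : M × G × M) (X : TangentSpace I g.1)
    (V : GroupLieAlgebra J G) :
    (trivialGroupoid I M J G).dRight g (tangentTriple I J (g.1, 1, g.1) (X, V, 0)) =
      tangentTriple I J g (X, groupRight J g.2.1 V, 0) :=
  mfderivWithin_rightTrans_apply g (g.1, 1, g.1) rfl X V

theorem dRightInv_trivialGroupoid (g : M × G × M) (X : TangentSpace I g.1)
    (V : TangentSpace J g.2.1) :
    (trivialGroupoid I M J G).dRightInv g (tangentTriple I J g (X, V, 0)) =
      tangentTriple I J (g.1, 1, g.1) (X, groupRightInv J g.2.1 V, 0) :=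
  mfderivWithin_rightTrans_apply ((trivialGroupoid I M J G).inv g) g rfl X V

theorem groupRight_one : groupRight J (1 : G) = ContinuousLinearMap.id ℝ _ := by
  have e : (fun b : G => b * 1) = id := funext mul_one
  rw [groupRight, e]
  exact mfderiv_id

theorem groupRightInv_one : groupRightInv J (1 : G) = ContinuousLinearMap.id ℝ _ := by
  have e : (fun b : G => b * 1⁻¹) = id := funext fun b => by simp
  rw [groupRightInv, e]
  exact mfderiv_id

theorem groupBivector_one (Λ : Bivector (GroupLieAlgebra J G)) :
    groupBivector J Λ (1 : G) = Λ := by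
  refine Bivector.ext_sharp fun ξ => ?_
  have h : (groupBivector J Λ (1 : G)).sharp ξ =
      groupRight J (1 : G) (Λ.sharp (ξ.comp (groupRight J (1 : G)))) := rfl
  rw [h, groupRight_one]
  rfl

theorem groupEndo_one (n : GroupLieAlgebra J G →L[ℝ] GroupLieAlgebra J G) :
    groupEndo J n (1 : G) = n := by
  rw [groupEndo, groupRight_one, groupRightInv_one]
  rfl

theorem tripleBivector_eq_rightBivector (Λ : Bivector (GroupLieAlgebra J G)) :
    tripleBivector I J PM (groupBivector J Λ) =
      (trivialGroupoid I M J G).rightBivector (trivialBivector I J PM Λ) := by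
  funext g
  refine Bivector.ext_sharp fun ξ => ?_
  have hR : ∀ (X : TangentSpace I g.1) (V : GroupLieAlgebra J G),
      ((trivialGroupoid I M J G).dRight g).comp
        ((trivialGroupoid I M J G).algebroid g.1).subtypeL (trivialAlgebroid I J g.1 (X, V)) =
      tangentTriple I J g (X, groupRight J g.2.1 V, 0) := dRight_trivialGroupoid g
  let D := (((trivialGroupoid I M J G).dRight g).comp
      ((trivialGroupoid I M J G).algebroid g.1).subtypeL).comp
        (trivialAlgebroid I J g.1).toContinuousLinearMap
  have e1 : (ξ.comp D).comp (ContinuousLinearMap.inl ℝ (TangentSpace I g.1) (GroupLieAlgebra J G)) =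
      coFst ξ :=
    ContinuousLinearMap.ext fun X => (congrArg ξ (hR X 0)).trans
      (congrArg (fun z : F => ξ ((X, z, 0) : E × F × E)) (map_zero (groupRight J g.2.1)))
  have e2 : (ξ.comp D).comp (ContinuousLinearMap.inr ℝ (TangentSpace I g.1) (GroupLieAlgebra J G)) =
      (coFst (coSnd ξ)).comp (groupRight J g.2.1) :=
    ContinuousLinearMap.ext fun V => congrArg ξ (hR 0 V)
  have h : ((trivialGroupoid I M J G).rightBivector (trivialBivector I J PM Λ) g).sharp ξ =
      D ((PM g.1).sharp ((ξ.comp D).comp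
          (ContinuousLinearMap.inl ℝ (TangentSpace I g.1) (GroupLieAlgebra J G))),
        Λ.sharp ((ξ.comp D).comp
          (ContinuousLinearMap.inr ℝ (TangentSpace I g.1) (GroupLieAlgebra J G)))) := rfl
  rw [h, e1, e2]
  exact (hR _ _).symm

theorem smoothBivectorSection_trivialBivector {Λ : Bivector (GroupLieAlgebra J G)}
    (h : SmoothBivector (I.prod (J.prod I)) (tripleBivector I J PM (groupBivector J Λ))) :
    (trivialGroupoid I M J G).SmoothBivectorSection (trivialBivector I J PM Λ) := by
  intro u v hu hv
  have hs := ContMDiff.comp (h u v hu hv) (trivialGroupoid I M J G).smooth_unit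
  have e : bivectorBracket (I.prod (J.prod I)) (tripleBivector I J PM (groupBivector J Λ)) u v ∘
      (trivialGroupoid I M J G).unit = fun x => (trivialBivector I J PM Λ x).eval
      ((dif (I.prod (J.prod I)) u ((trivialGroupoid I M J G).unit x)).comp
        ((trivialGroupoid I M J G).algebroid x).subtypeL)
      ((dif (I.prod (J.prod I)) v ((trivialGroupoid I M J G).unit x)).comp
        ((trivialGroupoid I M J G).algebroid x).subtypeL) := by
    funext x
    have h1 : bivectorBracket (I.prod (J.prod I)) (tripleBivector I J PM (groupBivector J Λ)) u v
        (x, 1, x) = dif (I.prod (J.prod I)) v (x, 1, x) (tangentTriple I J (x, 1, x)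
          ((PM x).sharp (coFst (dif (I.prod (J.prod I)) u (x, 1, x))),
          (groupBivector J Λ (1 : G)).sharp
            (coFst (coSnd (dif (I.prod (J.prod I)) u (x, 1, x)))), 0)) := rfl
    refine h1.trans ?_
    rw [groupBivector_one]
    rfl
  rw [e] at hs
  exact hs

theorem coe_trivialEndo_apply (n : GroupLieAlgebra J G →L[ℝ] GroupLieAlgebra J G) (x : M)
    (a : (trivialGroupoid I M J G).algebroid x) :
    (trivialEndo I J NM n x a).1 = tripleEndo I J NM (groupEndo J n) (x, (1 : G), x) a.1 := by
  have h1 : tripleEndo I J NM (groupEndo J n) (x, (1 : G), x) a.1 =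
      tangentTriple I J (x, (1 : G), x) (NM x ((tangentTriple I J (x, (1 : G), x)).symm a.1).1,
        groupEndo J n (1 : G) ((tangentTriple I J (x, (1 : G), x)).symm a.1).2.1, 0) := rfl
  rw [h1, groupEndo_one]
  rfl

theorem smoothEndoSection_trivialEndo {n : GroupLieAlgebra J G →L[ℝ] GroupLieAlgebra J G}
    (h : SmoothEndo (I.prod (J.prod I)) (tripleEndo I J NM (groupEndo J n))) :
    (trivialGroupoid I M J G).SmoothEndoSection (trivialEndo I J NM n) := by
  intro a ha
  have hs := ContMDiff.comp h ha
  have e : (fun x => (⟨(trivialGroupoid I M J G).unit x, trivialEndo I J NM n x (a x)⟩ :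
      TangentBundle (I.prod (J.prod I)) (M × G × M))) = fun x =>
      ⟨(trivialGroupoid I M J G).unit x,
        tripleEndo I J NM (groupEndo J n) ((trivialGroupoid I M J G).unit x) (a x)⟩ :=
    funext fun x => congrArg (Bundle.TotalSpace.mk _) (coe_trivialEndo_apply n x (a x))
  unfold LieGroupoid.SmoothSection
  rw [e]
  exact hs

theorem isRightEndo_trivialEndo (n : GroupLieAlgebra J G →L[ℝ] GroupLieAlgebra J G) :
    (trivialGroupoid I M J G).IsRightEndo (trivialEndo I J NM n)
      (tripleEndo I J NM (groupEndo J n)) := by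
  intro g v hv
  obtain ⟨⟨X, V, W⟩, rfl⟩ := (tangentTriple I J g).surjective v
  obtain rfl : W = 0 := (mem_vertical_trivialGroupoid I J g (X, V, W)).1 hv
  refine ⟨trivialAlgebroid I J g.1 (X, groupRightInv J g.2.1 V),
    (dRightInv_trivialGroupoid g X V).symm, ?_⟩
  exact (dRight_trivialGroupoid g (NM g.1 X) (n (groupRightInv J g.2.1 V))).symm

theorem mfderiv_tgt_tripleEndo (g : M × G × M) (v : TangentSpace (I.prod (J.prod I)) g) :
    mfderiv (I.prod (J.prod I)) I (trivialGroupoid I M J G).tgt g (tripleEndo I J NM NG g v) =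
      NM ((trivialGroupoid I M J G).tgt g)
        (mfderiv (I.prod (J.prod I)) I (trivialGroupoid I M J G).tgt g v) := by
  have h : mfderiv (I.prod (J.prod I)) I (trivialGroupoid I M J G).tgt g =
      ContinuousLinearMap.fst ℝ (TangentSpace I g.1) (TangentSpace (J.prod I) g.2) := mfderiv_fst
  rw [h]
  rfl

end TrivialGroupoid

end

theorem proposition4p2
    {E : Type*} [NormedAddCommGroup E] [NormedSpace ℝ E] [FiniteDimensional ℝ E]
    {H : Type*} [TopologicalSpace H] (I : ModelWithCorners ℝ E H) [I.Boundaryless]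
    {M : Type*} [TopologicalSpace M] [ChartedSpace H M] [IsManifold I ∞ M] [T2Space M]
    {F : Type*} [NormedAddCommGroup F] [NormedSpace ℝ F] [FiniteDimensional ℝ F]
    {K : Type*} [TopologicalSpace K] (J : ModelWithCorners ℝ F K) [J.Boundaryless]
    {G : Type*} [TopologicalSpace G] [ChartedSpace K G] [Group G] [LieGroup J ∞ G] [T2Space G]
    (PM : ∀ x : M, Bivector (TangentSpace I x))
    (NM : ∀ x : M, TangentSpace I x →L[ℝ] TangentSpace I x)
    (hM : IsPoissonNijenhuis I PM NM)
    (PG : ∀ a : G, Bivector (TangentSpace J a))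
    (NG : ∀ a : G, TangentSpace J a →L[ℝ] TangentSpace J a)
    (hG : IsRightInvariantPNGroup J PG NG) :
    (trivialGroupoid I M J G).IsRightInvariantPN
        (tripleBivector I J PM PG) (tripleEndo I J NM NG) NM ∧
      (∀ ΛG : Bivector (GroupLieAlgebra J G), PG = groupBivector J ΛG →
        (trivialGroupoid I M J G).SmoothBivectorSection (trivialBivector I J PM ΛG) ∧
        tripleBivector I J PM PG =
          (trivialGroupoid I M J G).rightBivector (trivialBivector I J PM ΛG)) ∧
      (∀ nG : GroupLieAlgebra J G →L[ℝ] GroupLieAlgebra J G, NG = groupEndo J nG →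
        (trivialGroupoid I M J G).SmoothEndoSection (trivialEndo I J NM nG) ∧
        (trivialGroupoid I M J G).IsRightEndo (trivialEndo I J NM nG)
          (tripleEndo I J NM NG)) := by
  have hpn := hM.triple hG.pn
  have hbiv : ∀ ΛG : Bivector (GroupLieAlgebra J G), PG = groupBivector J ΛG →
      (trivialGroupoid I M J G).SmoothBivectorSection (trivialBivector I J PM ΛG) ∧
      tripleBivector I J PM PG =
        (trivialGroupoid I M J G).rightBivector (trivialBivector I J PM ΛG) := by
    rintro ΛG rfl
    exact ⟨smoothBivectorSection_trivialBivector hpn.poisson.1, tripleBivector_eq_rightBivector ΛG⟩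
  have hend : ∀ nG : GroupLieAlgebra J G →L[ℝ] GroupLieAlgebra J G, NG = groupEndo J nG →
      (trivialGroupoid I M J G).SmoothEndoSection (trivialEndo I J NM nG) ∧
      (trivialGroupoid I M J G).IsRightEndo (trivialEndo I J NM nG) (tripleEndo I J NM NG) := by
    rintro nG rfl
    exact ⟨smoothEndoSection_trivialEndo hpn.nijenhuis.1, isRightEndo_trivialEndo nG⟩
  obtain ⟨ΛG, hΛ⟩ := hG.bivector
  obtain ⟨nG, hn⟩ := hG.endo
  exact ⟨⟨hpn, ⟨_, hbiv ΛG hΛ⟩, ⟨_, hend nG hn⟩, hM.nijenhuis, mfderiv_tgt_tripleEndo⟩, hbiv, hend⟩
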